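/- Let $(M',J,g')$ be a Kähler manifold with Norden metric of dimension $2n+2$, $n\ge 0$: $g'$ is a pseudo-Riemannian metric and $J$ an almost complex structure with $g'(Jx,Jy)=-g'(x,y)$ and $\nabla'J=0$, where $\nabla'$ is the Levi-Civita connection of $g'$. For a Levi-Civita connection $\nabla$ of a metric $g$, put $R(X,Y)Z=\nabla_X\nabla_YZ-\nabla_Y\nabla_XZ-\nabla_{[X,Y]}Z$ and $R(x,y,z,u)=g(R(x,y)z,u)$, and let $R'$ be the curvature tensor of $g'$. Assume that $M'$ is of constant totally real sectional curvatures $\nu',\tilde\nu'$, where $\nu',\tilde\nu'$ are real functions on $M'$: at each point $p'$, whenever $x,y$ span a nondegenerate section $\alpha'$ with $J\alpha'\perp\alpha'$, $$\frac{R'(x,y,y,x)}{g'(x,x)g'(y,y)-g'(x,y)^2}=\nu'(p'),\qquad \frac{R'(x,y,y,Jx)}{g'(x,x)g'(y,y)-g'(x,y)^2}=\tilde\nu'(p').$$ Let $M$ be a real time-like hypersurface of $M'$, that is, an immersed submanifold of dimension $2n+1$ with a smooth normal field $N$ such that $g'(N,N)=-1$, and with the structure $$t=\arctan g'(N,JN),\quad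 \varphi=J+\cos t\, g'(\cdot,JN)\{\cos t\,N-\sin t\,JN\},\quad \xi=\sin t\,N+\cos t\,JN,\quad \eta=\cos t\,g'(\cdot,JN),\quad g=g'|_M .$$ Let $A$ be its second fundamental tensor, $\nabla'_xN=-Ax$, and let $R$ be the curvature tensor of $g$. Put $$\begin{aligned} \pi_1(x,y,z,u)&=g(y,z)g(x,u)-g(x,z)g(y,u),\\ \pi_2(x,y,z,u)&=g(y,\varphi z)g(x,\varphi u)-g(x,\varphi z)g(y,\varphi u),\\ \pi_3(x,y,z,u)&=-g(y,z)g(x,\varphi u)+g(x,z)g(y,\varphi u)-g(y,\varphi z)g(x,u)+g(x,\varphi z)g(y,u),\\ \pi_4(x,y,z,u)&=\eta(y)\eta(z)g(x,u)-\eta(x)\eta(z)g(y,u)+\eta(x)\eta(u)g(y,z)-\eta(y)\eta(u)g(x,z),\\ \pi_5(x,y,z,u)&=\eta(y)\eta(z)g(x,\varphi u)-\eta(x)\eta(z)g(y,\varphi u)+\eta(x)\eta(u)g(y,\varphi z)-\eta(y)\eta(u)g(x,\varphi z). \end{aligned}$$ Let $\tau=g^{ij}g^{kl}R(e_k,e_i,e_j,e_l)$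 and $\tilde\tau=g^{ij}g^{kl}R(e_k,e_i,e_j,\varphi e_l)$ be the scalar curvatures of $R$ and of $\tilde R(x,y,z,u)=R(x,y,z,\varphi u)$, and let $k(x,y)=R(x,y,y,x)/\pi_1(x,y,y,x)$ be the sectional curvature of a nondegenerate section with basis $\{x,y\}$. Then, at each point of $M$ (with $\nu',\tilde\nu'$ evaluated at its image in $M'$): 1. for all tangent vectors $x,y,z,u$, $$R(x,y,z,u)=\{\nu'[\pi_1-\pi_2-\tan t\,\pi_5]+\tilde\nu'[\pi_3-\tan t\,\pi_4]\}(x,y,z,u)-\pi_1(Ax,Ay,z,u);$$ 2. $\tau=4n^2\nu'-4n\tilde\nu'\tan t-(\operatorname{tr}A)^2+\operatorname{tr}A^2$; 3. $\tilde\tau=2n\nu'\tan t+2n(2n-1)\tilde\nu'-\operatorname{tr}A\,\operatorname{tr}(A\circ\varphi)+\operatorname{tr}(A^2\circ\varphi)$; 4. for every nondegenerate $\xi$-section $\{\xi,x\}$, $$k(\xi,x)=\nu'-\tilde\nu'\tan t-[\nu'\tan t+\tilde\nu']\frac{g(x,\varphi x)}{g(x,x)-\eta(x)^2}-\frac{\pi_1(A\xi,Ax,x,\xi)}{g(x,x)-\eta(x)^2};$$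 5. for every nondegenerate $\varphi$-holomorphic section $\{\varphi x,\varphi^2x\}$, $$k(\varphi x,\varphi^2x)=-\frac{\pi_1(A\varphi x,A\varphi^2x,\varphi^2x,\varphi x)}{\pi_1(\varphi x,\varphi^2x,\varphi^2x,\varphi x)};$$ 6. for every nondegenerate totally real section $\alpha=\operatorname{span}\{x,y\}$ (i.e. $\alpha\perp\varphi\alpha$) orthogonal to $\xi$, $$k(x,y)=\nu'-\frac{\pi_1(Ax,Ay,y,x)}{\pi_1(x,y,y,x)}.$$ -/

import Mathlib

open scoped Manifold ContDiff

noncomputable section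

namespace NordenGeometry

/-! ### Algebraic curvature-like tensors of type (0,4) on a real vector space

`g` is a bilinear form, `f` an endomorphism (`J` or `φ`), `η` a linear form. -/

section Algebra

variable {V : Type*}

/-- `π₁(x,y,z,u) = g(y,z) g(x,u) - g(x,z) g(y,u)`. -/
def pi1 (g : V → V → ℝ) (x y z u : V) : ℝ :=
  g y z * g x u - g x z * g y u

/-- `π₂(x,y,z,u) = g(y,fz) g(x,fu) - g(x,fz) g(y,fu)`. -/
def pi2 (g : V → V → ℝ) (f : V → V) (x y z u : V) : ℝ :=
  g y (f z) * g x (f u) - g x (f z) * g y (f u)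

/-- `π₃(x,y,z,u) = -g(y,z) g(x,fu) + g(x,z) g(y,fu) - g(y,fz) g(x,u) + g(x,fz) g(y,u)`. -/
def pi3 (g : V → V → ℝ) (f : V → V) (x y z u : V) : ℝ :=
  -(g y z * g x (f u)) + g x z * g y (f u) - g y (f z) * g x u + g x (f z) * g y u

/-- `π₄(x,y,z,u) = η(y)η(z) g(x,u) - η(x)η(z) g(y,u) + η(x)η(u) g(y,z) - η(y)η(u) g(x,z)`. -/
def pi4 (g : V → V → ℝ) (η : V → ℝ) (x y z u : V) : ℝ :=
  η y * η z * g x u - η x * η z * g y u + η x * η u * g y z - η y * η u * g x z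

/-- `π₅(x,y,z,u) = η(y)η(z) g(x,fu) - η(x)η(z) g(y,fu) + η(x)η(u) g(y,fz) - η(y)η(u) g(x,fz)`. -/
def pi5 (g : V → V → ℝ) (f : V → V) (η : V → ℝ) (x y z u : V) : ℝ :=
  η y * η z * g x (f u) - η x * η z * g y (f u) + η x * η u * g y (f z) - η y * η u * g x (f z)

/-- The section spanned by `x, y` is nondegenerate for `g`: its Gram determinant
`π₁(x,y,y,x) = g(x,x) g(y,y) - g(x,y)²` does not vanish (in particular `x, y` are independent). -/
def NondegenerateSection (g : V → V → ℝ) (x y : V) : Prop :=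
  pi1 g x y y x ≠ 0

/-- The section `α` spanned by `x, y` is totally real: `α` is orthogonal to `f α`. -/
def TotallyRealSection (g : V → V → ℝ) (f : V → V) (x y : V) : Prop :=
  g x (f x) = 0 ∧ g x (f y) = 0 ∧ g y (f x) = 0 ∧ g y (f y) = 0

/-- The sectional curvature `L(x,y,y,x) / π₁(x,y,y,x)` of a section with basis `x, y`
with respect to a (0,4)-tensor `L`. -/
def sectionalCurvature (g : V → V → ℝ) (L : V → V → V → V → ℝ) (x y : V) : ℝ :=
  L x y y x / pi1 g x y y x

/-- The tensor associated with `L` by `f`: `L̃(x,y,z,u) = L(x,y,z,fu)`. -/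
def associatedTensor (f : V → V) (L : V → V → V → V → ℝ) (x y z u : V) : ℝ :=
  L x y z (f u)

variable [AddCommGroup V] [Module ℝ V] {ι : Type*} [Fintype ι] [DecidableEq ι]

/-- The inverse `(g^{ij})` of the matrix `(g_{ij}) = (g(e_i, e_j))` in a basis `e`. -/
def inverseGram (g : V → V → ℝ) (e : Module.Basis ι ℝ V) : Matrix ι ι ℝ :=
  (Matrix.of fun i j => g (e i) (e j))⁻¹

/-- The Ricci tensor `ρ(y,z) = g^{ij} L(e_i,y,z,e_j)` of a (0,4)-tensor `L`. -/
def ricciTensor (g : V → V → ℝ) (e : Module.Basis ι ℝ V) (L : V → V → V → V → ℝ) (y z : V) : ℝ :=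
  ∑ i, ∑ j, inverseGram g e i j * L (e i) y z (e j)

/-- The scalar curvature `g^{ij} ρ(e_i,e_j)` of a (0,4)-tensor `L`. -/
def scalarCurvature (g : V → V → ℝ) (e : Module.Basis ι ℝ V) (L : V → V → V → V → ℝ) : ℝ :=
  ∑ i, ∑ j, inverseGram g e i j * ricciTensor g e L (e i) (e j)

end Algebra

/-! ### Levi-Civita connection and curvature of a pseudo-Riemannian metric in charts

`c : M` labels the preferred chart `extChartAt 𝓘(ℝ, E) c` around `c`; coordinates are points of
`E`. -/

section LocalCoordinates

variable {E : Type*} [NormedAddCommGroup E] [NormedSpace ℝ E]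
  {M : Type*} [TopologicalSpace M] [ChartedSpace E M]

/-- A field of bilinear forms on the tangent spaces of `M`. -/
abbrev BilinField (E : Type*) [NormedAddCommGroup E] [NormedSpace ℝ E]
    (M : Type*) [TopologicalSpace M] [ChartedSpace E M] : Type _ :=
  ∀ p : M, TangentSpace 𝓘(ℝ, E) p →L[ℝ] TangentSpace 𝓘(ℝ, E) p →L[ℝ] ℝ

/-- The point with coordinates `a` in the chart around `c`. -/
def pointAt (c : M) (a : E) : M := (extChartAt 𝓘(ℝ, E) c).symm a

/-- The components, in the chart around `c`, of tangent vectors at `q`: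
the differential of the chart at `q`. -/
def components (c q : M) : TangentSpace 𝓘(ℝ, E) q →L[ℝ] E :=
  mfderiv 𝓘(ℝ, E) 𝓘(ℝ, E) (extChartAt 𝓘(ℝ, E) c) q

/-- The coordinate frame of the chart around `c`, at the point with coordinates `a`:
the differential of the inverse of the chart. -/
def coordFrame (c : M) (a : E) : E →L[ℝ] TangentSpace 𝓘(ℝ, E) (pointAt c a) :=
  mfderiv 𝓘(ℝ, E) 𝓘(ℝ, E) (pointAt c) a

/-- The metric `g` in the chart around `c`, as a function of the coordinates `a`. -/
def metricInChart (g : BilinField E M) (c : M) (a : E) : E →L[ℝ] E →L[ℝ] ℝ :=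
  (ContinuousLinearMap.precomp ℝ (coordFrame c a)) ∘L (g (pointAt c a)) ∘L (coordFrame c a)

/-- An endomorphism field `J` in the chart around `c`, as a function of the coordinates `a`. -/
def endInChart (J : ∀ p : M, TangentSpace 𝓘(ℝ, E) p →L[ℝ] TangentSpace 𝓘(ℝ, E) p)
    (c : M) (a : E) : E →L[ℝ] E :=
  (components c (pointAt c a)) ∘L (J (pointAt c a)) ∘L (coordFrame c a)

/-- Half of the right-hand side of the Koszul formula for constant fields `u, v, w` in
coordinates: `½ (D_u g(v,w) + D_v g(u,w) - D_w g(u,v))`, as a linear form in `w`. -/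
def christoffelLower (g : BilinField E M) (c : M) (a u v : E) : E →L[ℝ] ℝ :=
  (1 / 2 : ℝ) • (fderiv ℝ (metricInChart g c) a u v + fderiv ℝ (metricInChart g c) a v u
    - ((fderiv ℝ (metricInChart g c) a).flip u).flip v)

/-- The Christoffel symbols `Γ_a(u,v)` of the Levi-Civita connection of `g` in the chart around
`c`, so that `∇_u Y = D_u Y + Γ_a(u,Y)`; `Γ_a(u,v)` is obtained from `christoffelLower` by
raising the index with the inverse of `g`. -/
def christoffel (g : BilinField E M) (c : M) (a u v : E) : E :=
  (metricInChart g c a).inverse (christoffelLower g c a u v)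

theorem christoffel_add_left (g : BilinField E M) (c : M) (a u u' v : E) :
    christoffel g c a (u + u') v = christoffel g c a u v + christoffel g c a u' v := by
  rw [christoffel, christoffel, christoffel, ← map_add]
  congr 1
  ext w
  simp [christoffelLower]
  ring

theorem christoffel_smul_left (g : BilinField E M) (c : M) (r : ℝ) (a u v : E) :
    christoffel g c a (r • u) v = r • christoffel g c a u v := by
  rw [christoffel, christoffel, ← map_smul]
  congr 1
  ext w
  simp [christoffelLower]
  ring

/-- The curvature `R(u,v)w = ∇_u ∇_v w - ∇_v ∇_u w - ∇_{[u,v]} w` of the Levi-Civita connection of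
`g`, in the chart around `c`, at the coordinates `a`; `u, v, w` are extended to constant fields. -/
def curvatureInChart (g : BilinField E M) (c : M) (a u v w : E) : E :=
  fderiv ℝ (fun b => christoffel g c b v w) a u - fderiv ℝ (fun b => christoffel g c b u w) a v
    + christoffel g c a u (christoffel g c a v w) - christoffel g c a v (christoffel g c a u w)

/-- The curvature tensor `R(x,y,z,u) = g(R(x,y)z,u)` of the Levi-Civita connection of `g` at
`p`, computed in the chart around `p`. -/
def curvature (g : BilinField E M) (p : M) (x y z u : TangentSpace 𝓘(ℝ, E) p) : ℝ :=
  g p ((components p p).inverse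
    (curvatureInChart g p (extChartAt 𝓘(ℝ, E) p p)
      (components p p x) (components p p y) (components p p z))) u

end LocalCoordinates

/-! ### Kähler manifolds with Norden metric -/

section Kaehler

variable (E : Type*) [NormedAddCommGroup E] [NormedSpace ℝ E]
  (M : Type*) [TopologicalSpace M] [ChartedSpace E M] [IsManifold 𝓘(ℝ, E) ∞ M]

/-- A Kähler–Norden structure on a smooth manifold: a smooth pseudo-Riemannian metric `g` and a
smooth almost complex structure `J` with `g(Jx,Jy) = -g(x,y)` and `∇J = 0`
for the Levi-Civita connection `∇` of `g`. -/
structure KaehlerNorden where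
  /-- the Norden metric -/
  g : ∀ p : M, TangentSpace 𝓘(ℝ, E) p →L[ℝ] TangentSpace 𝓘(ℝ, E) p →L[ℝ] ℝ
  /-- the almost complex structure -/
  J : ∀ p : M, TangentSpace 𝓘(ℝ, E) p →L[ℝ] TangentSpace 𝓘(ℝ, E) p
  g_smooth : ContMDiff 𝓘(ℝ, E) (𝓘(ℝ, E).prod 𝓘(ℝ, E →L[ℝ] E →L[ℝ] ℝ)) ∞
    (fun p => Bundle.TotalSpace.mk' (E →L[ℝ] E →L[ℝ] ℝ)
      (E := fun p : M => TangentSpace 𝓘(ℝ, E) p →L[ℝ] TangentSpace 𝓘(ℝ, E) p →L[ℝ] ℝ) p (g p))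
  J_smooth : ContMDiff 𝓘(ℝ, E) (𝓘(ℝ, E).prod 𝓘(ℝ, E →L[ℝ] E)) ∞
    (fun p => Bundle.TotalSpace.mk' (E →L[ℝ] E)
      (E := fun p : M => TangentSpace 𝓘(ℝ, E) p →L[ℝ] TangentSpace 𝓘(ℝ, E) p) p (J p))
  g_symm : ∀ p x y, g p x y = g p y x
  g_nondegenerate : ∀ p x, (∀ y, g p x y = 0) → x = 0
  J_sq : ∀ p x, J p (J p x) = -x
  g_J : ∀ p x y, g p (J p x) (J p y) = -g p x y
  /-- `(∇_u J) v = D_u J v + Γ(u, J v) - J Γ(u, v) = 0` in every preferred chart. -/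
  J_parallel : ∀ c : M, ∀ a ∈ (extChartAt 𝓘(ℝ, E) c).target, ∀ u v : E,
    fderiv ℝ (fun b => endInChart J c b v) a u + christoffel g c a u (endInChart J c a v)
      - endInChart J c a (christoffel g c a u v) = 0

variable {E M}

/-- The totally real sectional curvatures are constant at each point, equal to `ν` (usual) and
`νt` (associated). -/
def KaehlerNorden.HasConstTotallyRealCurvatures (K : KaehlerNorden E M) (ν νt : M → ℝ) : Prop :=
  ∀ (p : M) (x y : TangentSpace 𝓘(ℝ, E) p),
    NondegenerateSection (fun a b => K.g p a b) x y →
    TotallyRealSection (fun a b => K.g p a b) (K.J p) x y →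
    sectionalCurvature (fun a b => K.g p a b) (curvature K.g p) x y = ν p ∧
    sectionalCurvature (fun a b => K.g p a b)
      (associatedTensor (K.J p) (curvature K.g p)) x y = νt p

end Kaehler

/-! ### Real time-like hypersurfaces -/

section Hypersurface

variable {E' : Type*} [NormedAddCommGroup E'] [NormedSpace ℝ E']
  {M' : Type*} [TopologicalSpace M'] [ChartedSpace E' M'] [IsManifold 𝓘(ℝ, E') ∞ M']

/-- A (smoothly immersed) submanifold `M` of `M'` with a smooth time-like unit normal field `N`,
`g'(N,N) = -1`. It is a hypersurface when `dim M + 1 = dim M'`. -/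
structure TimelikeHypersurface (K : KaehlerNorden E' M')
    (E : Type*) [NormedAddCommGroup E] [NormedSpace ℝ E]
    (M : Type*) [TopologicalSpace M] [ChartedSpace E M] [IsManifold 𝓘(ℝ, E) ∞ M] where
  /-- the immersion -/
  i : M → M'
  /-- the unit normal -/
  N : ∀ p : M, TangentSpace 𝓘(ℝ, E') (i p)
  i_smooth : ContMDiff 𝓘(ℝ, E) 𝓘(ℝ, E') ∞ i
  i_immersion : ∀ p, Function.Injective (mfderiv 𝓘(ℝ, E) 𝓘(ℝ, E') i p)
  N_smooth : ContMDiff 𝓘(ℝ, E) 𝓘(ℝ, E').tangent ∞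
    (fun p => (⟨i p, N p⟩ : TangentBundle 𝓘(ℝ, E') M'))
  N_normal : ∀ p x, K.g (i p) (N p) (mfderiv 𝓘(ℝ, E) 𝓘(ℝ, E') i p x) = 0
  N_unit : ∀ p, K.g (i p) (N p) (N p) = -1

namespace TimelikeHypersurface

variable {K : KaehlerNorden E' M'}
  {E : Type*} [NormedAddCommGroup E] [NormedSpace ℝ E]
  {M : Type*} [TopologicalSpace M] [ChartedSpace E M] [IsManifold 𝓘(ℝ, E) ∞ M]
  (S : TimelikeHypersurface K E M)

/-- The differential of the immersion. -/
def di (p : M) : TangentSpace 𝓘(ℝ, E) p →L[ℝ] TangentSpace 𝓘(ℝ, E') (S.i p) :=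
  mfderiv 𝓘(ℝ, E) 𝓘(ℝ, E') S.i p

/-- The induced metric `g = g'|_M`. -/
def g (p : M) : TangentSpace 𝓘(ℝ, E) p →L[ℝ] TangentSpace 𝓘(ℝ, E) p →L[ℝ] ℝ :=
  (ContinuousLinearMap.precomp ℝ (S.di p)) ∘L (K.g (S.i p)) ∘L (S.di p)

/-- The vector `JN`. -/
def JN (p : M) : TangentSpace 𝓘(ℝ, E') (S.i p) := K.J (S.i p) (S.N p)

/-- `t = arctan g'(N,JN)`. -/
def t (p : M) : ℝ := Real.arctan (K.g (S.i p) (S.N p) (S.JN p))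

/-- The tangential part of a vector of `M'` along `M`, as a vector of `M`: the unique vector
`w` with `g(w,x) = g'(v, di x)` for all `x`. If `v` is tangent to `M`, then `di w = v`. -/
def tangentialPart (p : M) : TangentSpace 𝓘(ℝ, E') (S.i p) →L[ℝ] TangentSpace 𝓘(ℝ, E) p :=
  (S.g p).inverse ∘L (ContinuousLinearMap.precomp ℝ (S.di p)) ∘L (K.g (S.i p))

/-- `η = cos t · g'(·,JN)` (with the arguments of the symmetric form `g'` exchanged). -/
def η (p : M) : TangentSpace 𝓘(ℝ, E) p →L[ℝ] ℝ :=
  Real.cos (S.t p) • (K.g (S.i p) (S.JN p) ∘L S.di p)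

/-- `ξ = sin t · N + cos t · JN`, which is tangent to `M`. -/
def ξ (p : M) : TangentSpace 𝓘(ℝ, E) p :=
  S.tangentialPart p (Real.sin (S.t p) • S.N p + Real.cos (S.t p) • S.JN p)

/-- `φ = J + cos t · g'(·,JN) {cos t · N - sin t · JN}`, which takes values tangent to `M`. -/
def φ (p : M) : TangentSpace 𝓘(ℝ, E) p →L[ℝ] TangentSpace 𝓘(ℝ, E) p :=
  S.tangentialPart p ∘L (K.J (S.i p) ∘L S.di p +
    (S.η p).smulRight (Real.cos (S.t p) • S.N p - Real.sin (S.t p) • S.JN p))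

/-- The derivative at `p` of the components of `N` in the chart of `M'` around `i p`. -/
def derivNormalComponents (p : M) : TangentSpace 𝓘(ℝ, E) p →L[ℝ] E' :=
  mfderiv 𝓘(ℝ, E) 𝓘(ℝ, E') (fun q : M => components (S.i p) (S.i q) (S.N q)) p

/-- The Levi-Civita covariant derivative `∇'_x N` of `N` along the immersion: in the chart of `M'`
around `i p`, it is `D_x N + Γ'(di x, N)`. -/
def nablaNormal (p : M) (x : TangentSpace 𝓘(ℝ, E) p) : TangentSpace 𝓘(ℝ, E') (S.i p) :=
  (components (S.i p) (S.i p)).inverse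
    (S.derivNormalComponents p x +
      christoffel K.g (S.i p) (extChartAt 𝓘(ℝ, E') (S.i p) (S.i p))
        (components (S.i p) (S.i p) (S.di p x)) (components (S.i p) (S.i p) (S.N p)))

/-- The second fundamental tensor `A`, given by the Weingarten formula `∇'_x N = -Ax`. -/
def A (p : M) : TangentSpace 𝓘(ℝ, E) p →ₗ[ℝ] TangentSpace 𝓘(ℝ, E) p where
  toFun x := -S.tangentialPart p (S.nablaNormal p x)
  map_add' x y := by
    have h : S.nablaNormal p (x + y) = S.nablaNormal p x + S.nablaNormal p y := by
      simp only [nablaNormal, map_add, christoffel_add_left]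
      abel
    rw [h, map_add, neg_add]
  map_smul' r x := by
    have h : S.nablaNormal p (r • x) = r • S.nablaNormal p x := by
      simp only [nablaNormal, map_smul, map_add, christoffel_smul_left, smul_add]
    rw [h, map_smul, RingHom.id_apply, smul_neg]

end TimelikeHypersurface

end Hypersurface

end NordenGeometry

/-! The theorem combines an algebraic classification of the ambient curvature tensor with the Gauss
equation; the scalar and sectional curvatures then follow by linear algebra at a point.

Ambient tensor. Since `J` is parallel, `R'(x,y)` commutes with `J`, and `J` is self-adjoint for
`g'`. View the tangent space as a complex vector space with `i` acting as `J`. Then `G = g' - i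
g'(·,J·)` is a nondegenerate complex symmetric form, and `L = R' - i R'(·,·,·,J·)` is a
complex-multilinear curvature tensor. A `G`-orthonormal pair spans a totally real section with Gram
determinant 1, so the hypothesis says that `L` has complex sectional curvature `ν' - i ν̃'` on such
pairs. Over `ℂ` every non-isotropic vector can be normalised, and a polynomial argument extends this
from nondegenerate sections to all sections. Hence `L` is `ν' - i ν̃'` times the Gram tensor of `G`,
and the real part reads `R' = ν'(π₁ - π₂) + ν̃' π₃` (`CurvatureLike.eq_zero_of_orthonormal`,
`curvature_eq_of_constTotallyReal`).

Hypersurface. In charts, the tangential part of the ambient connection is the Levi-Civita connection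
of the induced metric. Differentiating the Gauss formula once more gives `R = R' - π₁(A·,A·,·,·)`;
the sign is that of `g'(N,N) = -1` (`LocalHypersurface.gauss`, `gauss_equation`). On tangent vectors
`g'(x,Jy) = g(x,φy) + tan t η(x)η(y)` (`g_di_J_di`). Substituting this in `π₂` and `π₃` produces the
terms in `π₅` and `π₄`.

Consequences. `(φ,ξ,η,g)` is an almost contact Norden structure at each point. Every term of `R` has
the form `g(By,z)g(Cx,u) - g(Bx,z)g(Cy,u)` or is a sum of two such terms, and the scalar curvature
of one of these is `tr B tr C - tr(BC)` (`scalarCurvature_wedge`). The remaining input is `tr φ = 0`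
and `tr φ² = -2n`. -/

namespace NordenGeometry

/-! ### Curvature-like tensors -/

section CurvatureLike

variable {k W : Type*} [Field k] [AddCommGroup W] [Module k W]

/-- A (0,4)-tensor with the symmetries of a curvature tensor. Linearity is only required in the
first argument: it follows in the others. -/
structure CurvatureLike (k : Type*) {W : Type*} [Field k] [AddCommGroup W] [Module k W]
    (L : W → W → W → W → k) : Prop where
  add : ∀ x x' y z u, L (x + x') y z u = L x y z u + L x' y z u
  smul : ∀ (c : k) x y z u, L (c • x) y z u = c * L x y z u
  swap_left : ∀ x y z u, L y x z u = -L x y z u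
  swap_right : ∀ x y z u, L x y u z = -L x y z u
  bianchi : ∀ x y z u, L x y z u + L y z x u + L z x y u = 0

namespace CurvatureLike

variable {L L' : W → W → W → W → k}

/-- The classical octahedron argument: in a signed sum of four Bianchi identities every term cancels
except twice the difference of the two sides. -/
theorem pair_symm [CharZero k] (h : CurvatureLike k L) (x y z u : W) : L x y z u = L z u x y := by
  have sl := h.swap_left
  have sr := h.swap_right
  have e3 : L x z u y = L z x y u := by rw [sl, sr, neg_neg]
  have e6 : L y u x z = L u y z x := by rw [sl, sr, neg_neg]
  have : (2 : k) * (L x y z u - L z u x y) = 0 := by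
    linear_combination h.bianchi x y z u + h.bianchi y z u x - h.bianchi z u x y
      - h.bianchi u x y z - sr y z x u - sr z u x y + e3 + sr u x z y + sr x y z u + e6
  simpa [sub_eq_zero] using this

theorem add₂ (h : CurvatureLike k L) (x y y' z u : W) :
    L x (y + y') z u = L x y z u + L x y' z u := by
  rw [h.swap_left, h.add, h.swap_left x y, h.swap_left x y']; ring

theorem add₃ [CharZero k] (h : CurvatureLike k L) (x y z z' u : W) :
    L x y (z + z') u = L x y z u + L x y z' u := by
  rw [h.pair_symm, h.add, h.pair_symm z, h.pair_symm z']

theorem add₄ [CharZero k] (h : CurvatureLike k L) (x y z u u' : W) :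
    L x y z (u + u') = L x y z u + L x y z u' := by
  rw [h.pair_symm, h.add₂, h.pair_symm z, h.pair_symm z]

theorem smul₂ (h : CurvatureLike k L) (c : k) (x y z u : W) :
    L x (c • y) z u = c * L x y z u := by
  rw [h.swap_left, h.smul, h.swap_left x y]; ring

theorem smul₃ [CharZero k] (h : CurvatureLike k L) (c : k) (x y z u : W) :
    L x y (c • z) u = c * L x y z u := by
  rw [h.pair_symm, h.smul, h.pair_symm z]

theorem smul₄ [CharZero k] (h : CurvatureLike k L) (c : k) (x y z u : W) :
    L x y z (c • u) = c * L x y z u := by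
  rw [h.pair_symm, h.smul₂, h.pair_symm z]

theorem self_left [CharZero k] (h : CurvatureLike k L) (x z u : W) : L x x z u = 0 :=
  self_eq_neg.1 (h.swap_left x x z u)

theorem self_right [CharZero k] (h : CurvatureLike k L) (x y z : W) : L x y z z = 0 :=
  self_eq_neg.1 (h.swap_right x y z z)

/-- A curvature-like tensor is determined by its values `L(x,y,y,x)`. -/
theorem eq_zero [CharZero k] (h : CurvatureLike k L) (h0 : ∀ x y, L x y y x = 0) (x y z u : W) :
    L x y z u = 0 := by
  -- Polarise in the outer arguments; pair symmetry makes the two cross terms equal.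
  have h1 : ∀ x y u, L x y y u = 0 := by
    intro x y u
    have e := h0 (x + u) y
    rw [h.add, h.add₄, h.add₄, h0, h0] at e
    have p : L u y y x = L x y y u := by
      rw [h.pair_symm, h.swap_left, h.swap_right, neg_neg]
    rw [p] at e
    have : (2 : k) * L x y y u = 0 := by linear_combination e
    simpa using this
  -- Polarising in the inner arguments makes `L` alternate in its second and third slots too, so the
  -- three terms of the Bianchi identity coincide.
  have h2 : ∀ x y z u, L x y z u = -L x z y u := by
    intro x y z u
    have e := h1 x (y + z) u
    rw [h.add₂, h.add₃, h.add₃, h1, h1] at e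
    linear_combination e
  have h3 : (3 : k) * L x y z u = 0 := by
    linear_combination h.bianchi x y z u + h2 x y z u - h2 y z x u - h.swap_left x z y u
      + h.swap_left x y z u
  simpa using h3

theorem sub (h : CurvatureLike k L) (h' : CurvatureLike k L') :
    CurvatureLike k fun x y z u => L x y z u - L' x y z u where
  add x x' y z u := by simp only [h.add, h'.add]; ring
  smul c x y z u := by simp only [h.smul, h'.smul]; ring
  swap_left x y z u := by simp only [h.swap_left x, h'.swap_left x]; ring
  swap_right x y z u := by simp only [h.swap_right x y z, h'.swap_right x y z]; ring
  bianchi x y z u := by linear_combination h.bianchi x y z u - h'.bianchi x y z u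

theorem const_mul (h : CurvatureLike k L) (c : k) :
    CurvatureLike k fun x y z u => c * L x y z u where
  add x x' y z u := by simp only [h.add]; ring
  smul d x y z u := by simp only [h.smul]; ring
  swap_left x y z u := by simp only [h.swap_left x]; ring
  swap_right x y z u := by simp only [h.swap_right x y z]; ring
  bianchi x y z u := by linear_combination c * h.bianchi x y z u

/-- `L(x,y,y,x)` for fixed `x, y`, in terms of an arbitrary second vector of the same section. -/
theorem add_smul_right [CharZero k] (h : CurvatureLike k L) (c : k) (x y : W) :
    L x (y + c • x) (y + c • x) x = L x y y x := by
  simp [h.add₂, h.add₃, h.smul₂, h.smul₃, h.self_left, h.self_right]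

theorem add_left [CharZero k] (h : CurvatureLike k L) (x y : W) :
    L (x + y) y y (x + y) = L x y y x := by
  simp [h.add, h.add₄, h.self_left, h.self_right]

end CurvatureLike

/-- The curvature-like tensor of constant sectional curvature of a symmetric bilinear form. -/
def gramTensor (G : W →ₗ[k] W →ₗ[k] k) (x y z u : W) : k := G y z * G x u - G x z * G y u

theorem curvatureLike_gramTensor (G : W →ₗ[k] W →ₗ[k] k) (hG : ∀ x y, G x y = G y x) :
    CurvatureLike k (gramTensor G) where
  add x x' y z u := by simp [gramTensor]; ring
  smul c x y z u := by simp [gramTensor]; ring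
  swap_left x y z u := by simp [gramTensor]
  swap_right x y z u := by simp [gramTensor]; ring
  bianchi x y z u := by simp only [gramTensor, hG y x, hG z x, hG z y]; ring

end CurvatureLike

/-! ### Complex curvature-like tensors which vanish on orthonormal pairs -/

section Complex

variable {W : Type*} [AddCommGroup W] [Module ℂ W]

-- Along a complex line of pairs of vectors `L(x,y,y,x)` is a quartic polynomial in the parameter.
-- This algebraic form of continuity lets a vanishing statement pass from nondegenerate sections to
-- all sections.
open Polynomial in
theorem exists_polynomial_curvatureLike {L : W → W → W → W → ℂ} (h : CurvatureLike ℂ L)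
    (a b c d : W) : ∃ P : ℂ[X], ∀ s : ℂ,
      L (a + s • b) (c + s • d) (c + s • d) (a + s • b) = P.eval s := by
  refine ⟨C (L a c c a) + C (L b c c a + L a d c a + L a c d a + L a c c b) * X
    + C (L b d c a + L b c d a + L b c c b + L a d d a + L a d c b + L a c d b) * X ^ 2
    + C (L a d d b + L b c d b + L b d c b + L b d d a) * X ^ 3 + C (L b d d b) * X ^ 4,
    fun s => ?_⟩
  simp only [h.add, h.add₂, h.add₃, h.add₄, h.smul, h.smul₂, h.smul₃, h.smul₄, eval_add, eval_mul,
    eval_C, eval_X, eval_pow]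
  ring

variable {L : W → W → W → W → ℂ}

/-- Complex scalars enter here: `G x x` and `G y y` have square roots, so the pair can be rescaled
to an orthonormal one whatever the signature of the real metric was. -/
theorem CurvatureLike.eq_zero_of_orthogonal (h : CurvatureLike ℂ L)
    (G : W →ₗ[ℂ] W →ₗ[ℂ] ℂ)
    (H : ∀ x y, G x x = 1 → G y y = 1 → G x y = 0 → L x y y x = 0)
    {x y : W} (hx : G x x ≠ 0) (hy : G y y ≠ 0)
    (hxy : G x y = 0) : L x y y x = 0 := by
  obtain ⟨r, hr⟩ := IsAlgClosed.exists_pow_nat_eq (G x x) two_pos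
  obtain ⟨s, hs⟩ := IsAlgClosed.exists_pow_nat_eq (G y y) two_pos
  have hr0 : r ≠ 0 := by rintro rfl; simp at hr; exact hx hr.symm
  have hs0 : s ≠ 0 := by rintro rfl; simp at hs; exact hy hs.symm
  have := H (r⁻¹ • x) (s⁻¹ • y) (by simp [← hr]; field_simp) (by simp [← hs]; field_simp)
    (by simp [hxy])
  simpa [h.smul, h.smul₂, h.smul₃, h.smul₄, hr0, hs0] using this

theorem CurvatureLike.eq_zero_of_gram_ne_zero (h : CurvatureLike ℂ L)
    (G : W →ₗ[ℂ] W →ₗ[ℂ] ℂ) (hG : ∀ x y, G x y = G y x)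
    (H : ∀ x y, G x x = 1 → G y y = 1 → G x y = 0 → L x y y x = 0)
    {x y : W} (hxy : gramTensor G x y y x ≠ 0) :
    L x y y x = 0 := by
  have hgr := curvatureLike_gramTensor G hG
  have key : ∀ x y, G x x ≠ 0 → gramTensor G x y y x ≠ 0 → L x y y x = 0 := by
    intro x y hx hxy
    -- Gram–Schmidt: replacing `y` by its component orthogonal to `x` changes neither `L(x,y,y,x)`
    -- nor the Gram determinant.
    rw [← h.add_smul_right (-(G x y / G x x)) x y]
    have ho : G x (y + -(G x y / G x x) • x) = 0 := by simp; field_simp; ring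
    refine h.eq_zero_of_orthogonal G H hx ?_ ho
    rw [← hgr.add_smul_right (-(G x y / G x x)) x y] at hxy
    simp only [gramTensor, ho, zero_mul, sub_zero] at hxy
    exact left_ne_zero_of_mul hxy
  by_cases hx : G x x = 0
  · by_cases hy : G y y = 0
    · have hxy' : G x y ≠ 0 := by
        intro h0; apply hxy; simp [gramTensor, h0, hx]
      -- Both vectors are isotropic, but `x + y` is not, because `G (x + y) (x + y) = 2 G x y`.
      rw [← h.add_left]
      refine key _ _ ?_ (by rwa [hgr.add_left])
      simp [hx, hy, hG y x]
      simpa [← two_mul] using hxy'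
    · have e : ∀ {L : W → W → W → W → ℂ}, CurvatureLike ℂ L → L x y y x = L y x x y := by
        intro L h; rw [h.swap_left, h.swap_right, neg_neg]
      rw [e h]
      exact key y x hy (by rwa [← e hgr])
  · exact key x y hx hxy

/-- If some section is nondegenerate, nondegenerate sections are generic and vanishing on them is
enough. Otherwise the space has complex dimension at most one, where every curvature-like tensor is
zero. -/
theorem CurvatureLike.eq_zero_of_orthonormal (h : CurvatureLike ℂ L)
    (G : W →ₗ[ℂ] W →ₗ[ℂ] ℂ) (hG : ∀ x y, G x y = G y x)
    (H : ∀ x y, G x x = 1 → G y y = 1 → G x y = 0 → L x y y x = 0)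
    (hnd : ∀ x, (∀ y, G x y = 0) → x = 0)
    (x y z u : W) : L x y z u = 0 := by
  have hgr := curvatureLike_gramTensor G hG
  by_cases hex : ∃ a b, gramTensor G a b b a ≠ 0
  · obtain ⟨a, b, hab⟩ := hex
    refine h.eq_zero (fun x y => ?_) x y z u
    -- The line runs from `(x, y)` at `s = 0` to the nondegenerate pair `(a, b)` at `s = 1`. The
    -- product of `P` with the Gram polynomial `Q` vanishes everywhere and `Q` does not vanish at 1,
    -- so `P = 0`.
    obtain ⟨P, hP⟩ := exists_polynomial_curvatureLike h x (a - x) y (b - y)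
    obtain ⟨Q, hQ⟩ := exists_polynomial_curvatureLike hgr x (a - x) y (b - y)
    have hPQ : P * Q = 0 := by
      refine Polynomial.funext fun s => ?_
      rw [Polynomial.eval_mul, ← hP, ← hQ, Polynomial.eval_zero, mul_eq_zero]
      by_contra! hc
      exact hc.1 (h.eq_zero_of_gram_ne_zero G hG H hc.2)
    rcases mul_eq_zero.1 hPQ with h0 | h0
    · simpa [h0] using hP 0
    · refine absurd ?_ hab
      simpa [h0] using hQ 1
  · push Not at hex
    by_cases hex1 : ∃ a, G a a ≠ 0
    · obtain ⟨a, ha⟩ := hex1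
      -- All Gram determinants containing `a` vanish, so the orthogonal complement of `a` consists
      -- of isotropic vectors. By polarisation `G` is zero on it, and nondegeneracy makes it
      -- trivial.
      have hline : ∀ v : W, v = (G a v / G a a) • a := by
        intro v
        set w := v - (G a v / G a a) • a with hw
        have haw : ∀ v, G a (v - (G a v / G a a) • a) = 0 := by
          intro v; simp; field_simp; ring
        have hww : ∀ v, G (v - (G a v / G a a) • a) (v - (G a v / G a a) • a) = 0 := by
          intro v
          have := hex a (v - (G a v / G a a) • a)
          rw [gramTensor, haw v] at this
          simpa [ha] using this
        have : w = 0 := by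
          refine hnd w fun v' => ?_
          have e1 := hww (v + v')
          have e2 := hww v
          have e3 := hww v'
          have e4 := haw v
          rw [← hw] at e2 e4
          have d : v' = (v' - (G a v' / G a a) • a) + (G a v' / G a a) • a := by abel
          have s : v + v' - (G a (v + v') / G a a) • a = w + (v' - (G a v' / G a a) • a) := by
            rw [hw, map_add, add_div, add_smul]; abel
          rw [s, map_add, map_add, LinearMap.add_apply, LinearMap.add_apply, e2, e3,
            hG _ w] at e1
          have e5 : G w (v' - (G a v' / G a a) • a) = 0 := by
            have : (2 : ℂ) * G w (v' - (G a v' / G a a) • a) = 0 := by linear_combination e1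
            simpa using this
          rw [d, map_add, e5, map_smul, hG w a, e4]
          simp
        rw [hw, sub_eq_zero] at this
        exact this
      rw [hline x, hline y, h.smul, h.smul₂, h.self_left]
      simp
    · push Not at hex1
      -- Every vector is isotropic, so polarisation gives `G = 0` and nondegeneracy makes the space
      -- zero.
      have : x = 0 := by
        refine hnd x fun v => ?_
        have e := hex1 (x + v)
        rw [map_add, map_add, LinearMap.add_apply, LinearMap.add_apply, hex1, hex1, hG v x] at e
        have : (2 : ℂ) * G x v = 0 := by linear_combination e
        simpa using this
      rw [this, ← zero_smul ℂ (0 : W), h.smul, zero_mul]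

end Complex

/-! ### Constant totally real sectional curvatures -/

section Norden

variable {V : Type*} [AddCommGroup V] [Module ℝ V]

/-- For a Kähler–Norden curvature tensor, `J` can be moved between all arguments. -/
theorem CurvatureLike.apply_J_left {R : V → V → V → V → ℝ} (h : CurvatureLike ℝ R)
    (J : V →ₗ[ℝ] V) (hRJ : ∀ x y z u, R x y (J z) u = R x y z (J u)) (x y z u : V) :
    R (J x) y z u = R x y z (J u) := by
  have hJJ : ∀ x y z u, R (J x) y z u = R x (J y) z u := fun x y z u => by
    rw [h.pair_symm, hRJ, ← h.pair_symm]
  have hJm : ∀ x y z u, R x y z (J u) = -R x y u (J z) := fun x y z u => by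
    rw [← hRJ, h.swap_right]
  -- The defect `R(Jx,y,z,u) - R(x,y,z,Ju)` is itself curvature-like. For its Bianchi identity,
  -- summing the identities with `J` on one argument gives twice the cyclic sum of `R(Jx,y)z`.
  have hD : CurvatureLike ℝ fun x y z u => R (J x) y z u - R x y z (J u) :=
    { add := fun x x' y z u => by simp only [map_add, h.add]; ring
      smul := fun c x y z u => by simp only [map_smul, h.smul]; ring
      swap_left := fun x y z u => by
        simp only [h.swap_left x y, hJJ y x, h.swap_left (J x) y]; ring
      swap_right := fun x y z u => by
        simp only [h.swap_right _ _ z u, hJm x y u z]; ring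
      bianchi := fun x y z u => by
        have b1 := h.bianchi (J x) y z u
        have b2 := h.bianchi (J y) z x u
        have b3 := h.bianchi (J z) x y u
        have b := h.bianchi x y z (J u)
        have e1 := hRJ y z x u
        have e2 := hRJ z x y u
        have e3 := hRJ x y z u
        have f1 := hJJ z x y u
        have f2 := hJJ x y z u
        have f3 := hJJ y z x u
        linear_combination (1 / 2) * (b1 + b2 + b3) - (1 / 2) * (e1 + e2 + e3)
          + (1 / 2) * (f1 + f2 + f3) - (3 / 2) * b }
  have p := hD.pair_symm x y z u
  -- Pair symmetry of `R` makes the defect change sign when its pairs are exchanged, whereas being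
  -- curvature-like makes it invariant; hence it is zero.
  have q : R (J z) u x y - R z u x (J y) = -(R (J x) y z u - R x y z (J u)) := by
    rw [h.pair_symm (J z) u x y, h.pair_symm z u x (J y), hRJ, ← hJJ]; ring
  simp only [q] at p
  linarith

/-- The complex vector space structure of a real vector space with a complex structure `J`. -/
abbrev complexModule (J : V →ₗ[ℝ] V) (hJ : ∀ x, J (J x) = -x) : Module ℂ V :=
  Module.compHom V (Complex.lift ⟨J, by ext x; simp [hJ]⟩ : ℂ →ₐ[ℝ] Module.End ℝ V).toRingHom

theorem complexModule_smul (J : V →ₗ[ℝ] V) (hJ : ∀ x, J (J x) = -x) (c : ℂ) (x : V) :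
    (complexModule J hJ).toSMul.smul c x = c.re • x + c.im • J x := by
  change (Complex.lift ⟨J, _⟩ : ℂ →ₐ[ℝ] Module.End ℝ V) c x = _
  simp [Complex.lift, Complex.liftAux_apply, Module.algebraMap_end_apply]

/-- Kähler–Norden curvature tensors of constant totally real sectional curvatures. -/
theorem curvature_eq_of_constTotallyReal (g : V →ₗ[ℝ] V →ₗ[ℝ] ℝ) (J : V →ₗ[ℝ] V)
    (R : V → V → V → V → ℝ) (hg : ∀ x y, g x y = g y x) (hnd : ∀ x, (∀ y, g x y = 0) → x = 0)
    (hJ : ∀ x, J (J x) = -x) (hgJ : ∀ x y, g (J x) (J y) = -g x y) (hR : CurvatureLike ℝ R)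
    (hRJ : ∀ x y z u, R x y (J z) u = R x y z (J u)) (a b : ℝ)
    (H : ∀ x y, NondegenerateSection (fun x y => g x y) x y →
      TotallyRealSection (fun x y => g x y) J x y →
      sectionalCurvature (fun x y => g x y) R x y = a ∧
      sectionalCurvature (fun x y => g x y) (associatedTensor J R) x y = b) (x y z u : V) :
    R x y z u = a * (pi1 (fun x y => g x y) x y z u - pi2 (fun x y => g x y) J x y z u)
      + b * pi3 (fun x y => g x y) J x y z u := by
  let _ : Module ℂ V := complexModule J hJ
  have hsm : ∀ (c : ℂ) (x : V), c • x = c.re • x + c.im • J x := complexModule_smul J hJ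
  have hgJ' : ∀ x y, g (J x) y = g x (J y) := fun x y => by
    have := hgJ x (J y)
    rw [hJ, map_neg] at this
    linarith
  let G : V →ₗ[ℂ] V →ₗ[ℂ] ℂ := LinearMap.mk₂ ℂ (fun x y => ⟨g x y, -g x (J y)⟩)
    (fun x x' y => by apply Complex.ext <;> simp; ring)
    (fun c x y => by
      apply Complex.ext <;> simp [hsm, hgJ', hJ]
      ring)
    (fun x y y' => by apply Complex.ext <;> simp; ring)
    (fun c x y => by
      apply Complex.ext <;> simp [hsm, hJ]
      ring)
  have hGa : ∀ x y, G x y = ⟨g x y, -g x (J y)⟩ := fun x y => rfl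
  have hGs : ∀ x y, G x y = G y x := fun x y => by
    rw [hGa, hGa, hg x y, ← hgJ' x, hg (J x)]
  have hL : CurvatureLike ℂ fun x y z u => (⟨R x y z u, -R x y z (J u)⟩ : ℂ) :=
    { add := fun x x' y z u => by apply Complex.ext <;> simp [hR.add]; ring
      smul := fun c x y z u => by
        have e : R x y z (J (J u)) = - R x y z u := by
          rw [hJ, ← neg_one_smul ℝ u, hR.smul₄]; ring
        apply Complex.ext <;> simp [hsm, hR.add, hR.smul, hR.apply_J_left J hRJ, e]
        ring
      swap_left := fun x y z u => by apply Complex.ext <;> simp [hR.swap_left x y]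
      swap_right := fun x y z u => by
        apply Complex.ext
        · simp [hR.swap_right x y z]
        · simp [← hRJ x y z, hR.swap_right x y u]
      bianchi := fun x y z u => by
        apply Complex.ext
        · simp [hR.bianchi]
        · have := hR.bianchi x y z (J u)
          simp
          linarith }
  -- The factor `a - ib` is the value of `L(x,y,y,x)` on a `G`-orthonormal pair. Taking real parts
  -- then yields `π₁ - π₂` with coefficient `a` and `π₃` with coefficient `b`.
  have h0 := (hL.sub ((curvatureLike_gramTensor G hGs).const_mul ⟨a, -b⟩)).eq_zero_of_orthonormal
    G hGs (fun x y hx hy hxy => ?_) (fun x hx => hnd x fun y => congrArg Complex.re (hx y)) x y z u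
  · have := congrArg Complex.re h0
    simp [gramTensor, hGa] at this
    simp only [pi1, pi2, pi3]
    linear_combination this
  · have hx1 : g x x = 1 := congrArg Complex.re hx
    have hx2 : g x (J x) = 0 := neg_eq_zero.1 (congrArg Complex.im hx)
    have hy1 : g y y = 1 := congrArg Complex.re hy
    have hy2 : g y (J y) = 0 := neg_eq_zero.1 (congrArg Complex.im hy)
    have hxy1 : g x y = 0 := congrArg Complex.re hxy
    have hxy2 : g x (J y) = 0 := neg_eq_zero.1 (congrArg Complex.im hxy)
    have hyx2 : g y (J x) = 0 := by rw [hg, hgJ', hxy2]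
    have hpi : pi1 (fun x y => g x y) x y y x = 1 := by simp [pi1, hx1, hy1, hxy1]
    obtain ⟨h1, h2⟩ := H x y (by rw [NondegenerateSection, hpi]; exact one_ne_zero)
      ⟨hx2, hxy2, hyx2, hy2⟩
    rw [sectionalCurvature, hpi, div_one] at h1 h2
    rw [associatedTensor] at h2
    rw [gramTensor, hx, hy, hxy, h1, h2]
    simp

end Norden

/-! ### Scalar curvatures as traces -/

section Trace

variable {V : Type*} [AddCommGroup V] [Module ℝ V] {ι : Type*} [Fintype ι] [DecidableEq ι]
  (g : V →ₗ[ℝ] V →ₗ[ℝ] ℝ) (e : Module.Basis ι ℝ V)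

/-- A kernel vector of the Gram matrix would be the coordinate vector of an element of the radical.
Invertibility is needed because `Matrix` inversion returns a default value on singular matrices. -/
theorem gram_isUnit_det (hnd : ∀ x, (∀ y, g y x = 0) → x = 0) :
    IsUnit (Matrix.of fun i j => g (e i) (e j)).det := by
  rw [isUnit_iff_ne_zero]
  intro h
  obtain ⟨v, hv, hv0⟩ := Matrix.exists_mulVec_eq_zero_iff.2 h
  refine hv ?_
  have h1 : ∀ i, g (e i) (∑ j, v j • e j) = 0 := fun i => by
    have := congrFun hv0 i
    simp only [Matrix.mulVec, dotProduct, Matrix.of_apply, Pi.zero_apply] at this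
    rw [map_sum, ← this]
    exact Finset.sum_congr rfl fun j _ => by simp [mul_comm]
  have h2 : ∑ j, v j • e j = 0 := hnd _ fun y => by
    generalize ∑ j, v j • e j = w at h1
    conv_lhs => rw [← e.sum_repr y, map_sum, LinearMap.sum_apply]
    exact Finset.sum_eq_zero fun i _ => by rw [map_smul, LinearMap.smul_apply, h1, smul_zero]
  funext i
  exact Fintype.linearIndependent_iff.1 e.linearIndependent v h2 i

variable {g}

/-- Raising the index of `g v (e j)` recovers the coordinates of `v`; this turns metric contractions
into traces independent of the basis. -/
theorem sum_inverseGram_mul (hg : ∀ x y, g x y = g y x) (hnd : ∀ x, (∀ y, g x y = 0) → x = 0)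
    (v : V) (i : ι) :
    ∑ j, inverseGram (fun x y => g x y) e i j * g v (e j) = e.repr v i := by
  have hu := gram_isUnit_det g e fun x hx => hnd x fun y => (hg x y).trans (hx y)
  have hm := Matrix.nonsing_inv_mul _ hu
  have h1 : ∀ j, g v (e j) = ∑ k, g (e j) (e k) * e.repr v k := fun j => by
    conv_lhs => rw [hg, ← e.sum_repr v, map_sum]
    exact Finset.sum_congr rfl fun k _ => by simp [mul_comm]
  have h2 : ∑ j, inverseGram (fun x y => g x y) e i j * g v (e j)
      = (((Matrix.of fun i j => g (e i) (e j))⁻¹).mulVec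
        ((Matrix.of fun i j => g (e i) (e j)).mulVec (e.repr v))) i := by
    simp only [Matrix.mulVec, dotProduct, Matrix.of_apply, inverseGram, h1]
  rw [h2, Matrix.mulVec_mulVec, hm, Matrix.one_mulVec]

theorem sum_sum_inverseGram_mul (hg : ∀ x y, g x y = g y x)
    (hnd : ∀ x, (∀ y, g x y = 0) → x = 0) (B : V →ₗ[ℝ] V) :
    ∑ i, ∑ j, inverseGram (fun x y => g x y) e i j * g (B (e i)) (e j)
      = LinearMap.trace ℝ V B := by
  simp only [sum_inverseGram_mul e hg hnd]
  rw [LinearMap.trace_eq_matrix_trace ℝ e, Matrix.trace]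
  simp [LinearMap.toMatrix_apply]

/-- The scalar curvature contracts slots 1 with 4 and 2 with 3, which here belong to separate
factors. -/
theorem scalarCurvature_trace_mul_trace (hg : ∀ x y, g x y = g y x)
    (hnd : ∀ x, (∀ y, g x y = 0) → x = 0) (B C : V →ₗ[ℝ] V) :
    scalarCurvature (fun x y => g x y) e (fun x y z u => g (B y) z * g (C x) u)
      = LinearMap.trace ℝ V B * LinearMap.trace ℝ V C := by
  rw [← sum_sum_inverseGram_mul e hg hnd B, ← sum_sum_inverseGram_mul e hg hnd C,
    Finset.sum_mul]
  refine Finset.sum_congr rfl fun i _ => ?_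
  rw [Finset.sum_mul]
  refine Finset.sum_congr rfl fun j _ => ?_
  rw [ricciTensor, mul_assoc, Finset.mul_sum (a := g (B (e i)) (e j))]
  congr 1
  refine Finset.sum_congr rfl fun k _ => ?_
  rw [Finset.mul_sum]
  exact Finset.sum_congr rfl fun l _ => by ring

/-- Here each contraction links the two factors, so the two endomorphisms are composed. -/
theorem scalarCurvature_trace_comp (hg : ∀ x y, g x y = g y x)
    (hnd : ∀ x, (∀ y, g x y = 0) → x = 0) (B C : V →ₗ[ℝ] V) :
    scalarCurvature (fun x y => g x y) e (fun x y z u => g (B x) z * g (C y) u)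
      = LinearMap.trace ℝ V (B ∘ₗ C) := by
  rw [← sum_sum_inverseGram_mul e hg hnd]
  refine Finset.sum_congr rfl fun i _ => Finset.sum_congr rfl fun j _ => ?_
  congr 1
  rw [ricciTensor, LinearMap.comp_apply]
  conv_rhs => rw [← e.sum_repr (C (e i)), map_sum, map_sum, LinearMap.sum_apply]
  refine Finset.sum_congr rfl fun k _ => ?_
  rw [← sum_inverseGram_mul e hg hnd, map_smul, map_smul, LinearMap.smul_apply, smul_eq_mul,
    Finset.sum_mul]
  exact Finset.sum_congr rfl fun l _ => by ring

theorem scalarCurvature_add (g : V → V → ℝ) (L L' : V → V → V → V → ℝ) :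
    scalarCurvature g e (fun x y z u => L x y z u + L' x y z u)
      = scalarCurvature g e L + scalarCurvature g e L' := by
  simp only [scalarCurvature, ricciTensor, mul_add, Finset.sum_add_distrib]

theorem scalarCurvature_const_mul (g : V → V → ℝ) (c : ℝ) (L : V → V → V → V → ℝ) :
    scalarCurvature g e (fun x y z u => c * L x y z u) = c * scalarCurvature g e L := by
  simp only [scalarCurvature, ricciTensor, Finset.mul_sum]
  refine Finset.sum_congr rfl fun i _ => Finset.sum_congr rfl fun j _ =>
    Finset.sum_congr rfl fun k _ => Finset.sum_congr rfl fun l _ => by ring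

theorem scalarCurvature_sub (g : V → V → ℝ) (L L' : V → V → V → V → ℝ) :
    scalarCurvature g e (fun x y z u => L x y z u - L' x y z u)
      = scalarCurvature g e L - scalarCurvature g e L' := by
  simp only [scalarCurvature, ricciTensor, mul_sub, Finset.sum_sub_distrib]

/-- The tensor `g(By,z) g(Cx,u) - g(Bx,z) g(Cy,u)`. -/
def wedge (g : V →ₗ[ℝ] V →ₗ[ℝ] ℝ) (B C : V →ₗ[ℝ] V) (x y z u : V) : ℝ :=
  g (B y) z * g (C x) u - g (B x) z * g (C y) u

theorem scalarCurvature_wedge (hg : ∀ x y, g x y = g y x)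
    (hnd : ∀ x, (∀ y, g x y = 0) → x = 0) (B C : V →ₗ[ℝ] V) :
    scalarCurvature (fun x y => g x y) e (wedge g B C)
      = LinearMap.trace ℝ V B * LinearMap.trace ℝ V C - LinearMap.trace ℝ V (B ∘ₗ C) := by
  rw [← scalarCurvature_trace_mul_trace e hg hnd, ← scalarCurvature_trace_comp e hg hnd,
    ← scalarCurvature_sub]
  rfl

/-- An endomorphism with `φ³ = -φ` of a real vector space is trace-free. -/
theorem trace_eq_zero_of_cube_eq_neg [FiniteDimensional ℝ V] (φ : V →ₗ[ℝ] V)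
    (h : ∀ x, φ (φ (φ x)) = -φ x) : LinearMap.trace ℝ V φ = 0 := by
  let b := Module.finBasis ℝ V
  rw [LinearMap.trace_eq_matrix_trace ℝ b]
  set P := LinearMap.toMatrix b b φ with hP
  have hP3 : P * P * P = -P := by
    rw [hP, ← LinearMap.toMatrix_comp, ← LinearMap.toMatrix_comp, ← map_neg]
    congr 1
    ext x
    simp [h]
  -- Over `ℂ` the eigenvalues are among `0, i, -i`, so the trace, their sum with multiplicity, has
  -- real part zero; but the trace is real.
  let Q : Matrix _ _ ℂ := P.map (algebraMap ℝ ℂ)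
  have hQ3 : Q * Q * Q = -Q := by
    simp only [Q, ← Matrix.map_mul, hP3]
    ext i j
    simp
  have hQP : Q.trace = (P.trace : ℂ) := by
    simp [Q, Matrix.trace]
  have hre : Q.trace.re = 0 := by
    rw [Matrix.trace_eq_sum_roots_charpoly]
    have hr : ∀ z ∈ Q.charpoly.roots, z.re = 0 := by
      intro z hz
      rw [← Matrix.charpoly_toLin'] at hz
      have hz' : Module.End.HasEigenvalue (Matrix.toLin' Q) z := by
        rw [Module.End.hasEigenvalue_iff_isRoot_charpoly]
        exact Polynomial.isRoot_of_mem_roots hz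
      obtain ⟨v, hv⟩ := hz'.exists_hasEigenvector
      have e1 : Q.mulVec v = z • v := by simpa using hv.apply_eq_smul
      have e2 : (Q * Q * Q).mulVec v = (z * z * z) • v := by
        rw [← Matrix.mulVec_mulVec, ← Matrix.mulVec_mulVec, e1, Matrix.mulVec_smul, e1,
          Matrix.mulVec_smul, Matrix.mulVec_smul, e1, smul_smul, smul_smul]
      rw [hQ3, Matrix.neg_mulVec, e1, ← neg_smul] at e2
      have e3 : -z = z * z * z := smul_left_injective ℂ hv.2 e2
      have e4 : z * (z ^ 2 + 1) = 0 := by linear_combination -e3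
      rcases mul_eq_zero.1 e4 with e | e
      · simp [e]
      · have : (z - Complex.I) * (z + Complex.I) = 0 := by
          linear_combination e - Complex.I_sq
        rcases mul_eq_zero.1 this with e | e
        · simp [sub_eq_zero.1 e]
        · simp [eq_neg_of_add_eq_zero_left e]
    have hs : ∀ s : Multiset ℂ, (∀ z ∈ s, z.re = 0) → s.sum.re = 0 := by
      intro s
      induction s using Multiset.induction_on with
      | empty => simp
      | cons a s ih =>
        intro hz
        simp [hz a (Multiset.mem_cons_self _ _), ih fun z hz' => hz z (Multiset.mem_cons_of_mem hz')]
    exact hs _ hr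
  rw [hQP] at hre
  simpa using hre

end Trace

/-! ### Consequences of the formula for the curvature tensor of a hypersurface -/

section AlmostContact

/-- The pointwise structure `(φ, ξ, η, g)` of an almost contact manifold with Norden metric. -/
structure AlmostContactNorden {V : Type*} [AddCommGroup V] [Module ℝ V]
    (g : V →ₗ[ℝ] V →ₗ[ℝ] ℝ) (φ : V →ₗ[ℝ] V) (ξ : V) (η : V →ₗ[ℝ] ℝ) : Prop where
  symm : ∀ x y, g x y = g y x
  nondegenerate : ∀ x, (∀ y, g x y = 0) → x = 0
  ξ_unit : g ξ ξ = 1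
  η_eq : ∀ x, g x ξ = η x
  φ_symm : ∀ x y, g (φ x) y = g x (φ y)
  φ_ξ : φ ξ = 0
  φ_sq : ∀ x, φ (φ x) = -x + η x • ξ

/-- The curvature tensor of a hypersurface with second fundamental tensor `A`. -/
def hypersurfaceTensor {V : Type*} [AddCommGroup V] [Module ℝ V] (g : V →ₗ[ℝ] V →ₗ[ℝ] ℝ)
    (φ : V →ₗ[ℝ] V) (η : V →ₗ[ℝ] ℝ) (A : V →ₗ[ℝ] V) (T a b : ℝ) (x y z u : V) : ℝ :=
  a * (pi1 (fun x y => g x y) x y z u - pi2 (fun x y => g x y) φ x y z u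
      - T * pi5 (fun x y => g x y) φ η x y z u)
    + b * (pi3 (fun x y => g x y) φ x y z u - T * pi4 (fun x y => g x y) η x y z u)
    - pi1 (fun x y => g x y) (A x) (A y) z u

namespace AlmostContactNorden

variable {V : Type*} [AddCommGroup V] [Module ℝ V]
  {g : V →ₗ[ℝ] V →ₗ[ℝ] ℝ} {φ : V →ₗ[ℝ] V} {ξ : V} {η : V →ₗ[ℝ] ℝ}
  (h : AlmostContactNorden g φ ξ η)

include h

theorem η_ξ : η ξ = 1 := by rw [← h.η_eq, h.ξ_unit]

theorem η_φ (x : V) : η (φ x) = 0 := by rw [← h.η_eq, h.φ_symm, h.φ_ξ, map_zero]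

theorem φ_cube (x : V) : φ (φ (φ x)) = -φ x := by
  rw [h.φ_sq (φ x), h.η_φ, zero_smul, add_zero]

/-- Since `η(y)η(z) = g(η(y)ξ, z)` and `φ` is self-adjoint, all five tensors are combinations of
`wedge` terms built from `id`, `φ` and `η ⊗ ξ`, to which the trace formula applies. -/
theorem hypersurfaceTensor_eq (A : V →ₗ[ℝ] V) (T a b : ℝ) :
    hypersurfaceTensor g φ η A T a b = fun x y z u =>
      a * (wedge g .id .id x y z u - wedge g φ φ x y z u
        - T * (wedge g (η.smulRight ξ) φ x y z u + wedge g φ (η.smulRight ξ) x y z u))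
      + b * ((-1) * (wedge g .id φ x y z u + wedge g φ .id x y z u)
        - T * (wedge g (η.smulRight ξ) .id x y z u + wedge g .id (η.smulRight ξ) x y z u))
      - wedge g A A x y z u := by
  funext x y z u
  simp only [hypersurfaceTensor, pi1, pi2, pi3, pi4, pi5, wedge, LinearMap.id_apply,
    LinearMap.smulRight_apply, map_smul, LinearMap.smul_apply, smul_eq_mul, h.symm ξ, h.η_eq,
    h.φ_symm]
  ring

variable [FiniteDimensional ℝ V]

theorem trace_φ : LinearMap.trace ℝ V φ = 0 := trace_eq_zero_of_cube_eq_neg φ h.φ_cube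

theorem trace_φ_comp_φ :
    LinearMap.trace ℝ V (φ ∘ₗ φ) = -(Module.finrank ℝ V : ℝ) + 1 := by
  have : φ ∘ₗ φ = -LinearMap.id + η.smulRight ξ := by
    ext x; simp [h.φ_sq]
  rw [this, map_add, map_neg, LinearMap.trace_id, LinearMap.trace_smulRight, h.η_ξ]

variable {ι : Type*} [Fintype ι] [DecidableEq ι] (e : Module.Basis ι ℝ V)

/-- The contributions are `2n(2n+1)` from `π₁`, `-tr φ² = 2n` from `π₂` and `4n` from `π₄`; those of
`π₃` and `π₅` vanish because `tr φ = 0` and `φ` annihilates `ξ`. -/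
theorem scalarCurvature_hypersurfaceTensor {n : ℕ} (hn : Module.finrank ℝ V = 2 * n + 1)
    (A : V →ₗ[ℝ] V) (T a b : ℝ) :
    scalarCurvature (fun x y => g x y) e (hypersurfaceTensor g φ η A T a b) =
      4 * n ^ 2 * a - 4 * n * b * T - (LinearMap.trace ℝ _ A) ^ 2
        + LinearMap.trace ℝ _ (A ∘ₗ A) := by
  have c1 : (η.smulRight ξ) ∘ₗ φ = 0 := by ext x; simp [h.η_φ]
  have c2 : φ ∘ₗ (η.smulRight ξ) = 0 := by ext x; simp [h.φ_ξ]
  simp only [h.hypersurfaceTensor_eq, scalarCurvature_sub, scalarCurvature_add,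
    scalarCurvature_const_mul, scalarCurvature_wedge e h.symm h.nondegenerate, c1, c2,
    LinearMap.comp_id, LinearMap.id_comp, h.trace_φ, h.trace_φ_comp_φ, LinearMap.trace_id,
    LinearMap.trace_smulRight, h.η_ξ, hn, map_zero]
  push_cast
  ring

theorem scalarCurvature_associatedTensor {n : ℕ} (hn : Module.finrank ℝ V = 2 * n + 1)
    (A : V →ₗ[ℝ] V) (T a b : ℝ) :
    scalarCurvature (fun x y => g x y) e
      (associatedTensor φ (hypersurfaceTensor g φ η A T a b)) =
      2 * n * a * T + 2 * n * (2 * n - 1) * b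
        - LinearMap.trace ℝ _ A * LinearMap.trace ℝ _ (A ∘ₗ φ)
        + LinearMap.trace ℝ _ (A ∘ₗ A ∘ₗ φ) := by
  -- Self-adjointness moves `φ` from the last argument onto `C`, so the associated tensor is again a
  -- sum of `wedge` terms.
  have hw : ∀ B C : V →ₗ[ℝ] V, ∀ x y z u, wedge g B C x y z (φ u) = wedge g B (φ ∘ₗ C) x y z u :=
    fun B C x y z u => by simp [wedge, h.φ_symm]
  have c1 : (η.smulRight ξ) ∘ₗ φ = 0 := by ext x; simp [h.η_φ]
  have c2 : φ ∘ₗ (η.smulRight ξ) = 0 := by ext x; simp [h.φ_ξ]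
  have c3 : φ ∘ₗ φ ∘ₗ φ = -φ := by ext x; simp [h.φ_cube]
  have c4 : (η.smulRight ξ) ∘ₗ φ ∘ₗ φ = 0 := by ext x; simp [h.η_φ]
  have t1 : LinearMap.trace ℝ V (φ ∘ₗ A) = LinearMap.trace ℝ V (A ∘ₗ φ) :=
    LinearMap.trace_comp_comm' _ _
  have t2 : LinearMap.trace ℝ V (A ∘ₗ φ ∘ₗ A) = LinearMap.trace ℝ V (A ∘ₗ A ∘ₗ φ) := by
    rw [← LinearMap.comp_assoc, LinearMap.trace_comp_comm']
  rw [h.hypersurfaceTensor_eq]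
  unfold associatedTensor
  simp only [hw, scalarCurvature_sub, scalarCurvature_add,
    scalarCurvature_const_mul, scalarCurvature_wedge e h.symm h.nondegenerate, c1, c2, c3, c4,
    LinearMap.comp_id, LinearMap.id_comp, LinearMap.comp_zero, h.trace_φ, h.trace_φ_comp_φ,
    LinearMap.trace_id, LinearMap.trace_smulRight, h.η_ξ, hn, map_zero, map_neg, t1, t2]
  push_cast
  ring

omit [FiniteDimensional ℝ V]

theorem sectionalCurvature_ξ (A : V →ₗ[ℝ] V) (T a b : ℝ) (x : V)
    (hx : NondegenerateSection (fun x y => g x y) ξ x) :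
    sectionalCurvature (fun x y => g x y) (hypersurfaceTensor g φ η A T a b) ξ x =
      a - b * T - (a * T + b) * (g x (φ x) / (g x x - η x ^ 2))
        - pi1 (fun x y => g x y) (A ξ) (A x) x ξ / (g x x - η x ^ 2) := by
  have hd : pi1 (fun x y => g x y) ξ x x ξ = g x x - η x ^ 2 := by
    simp only [pi1, h.ξ_unit, h.symm ξ x, h.η_eq]; ring
  rw [NondegenerateSection, hd] at hx
  rw [sectionalCurvature, hd]
  field_simp
  simp only [hypersurfaceTensor, pi2, pi3, pi4, pi5, hd, h.φ_ξ, map_zero, h.η_ξ, h.ξ_unit,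
    h.symm ξ x, h.η_eq, ← h.φ_symm, LinearMap.zero_apply]
  ring

/-- With `X = φx` one has `φ²X = -X` and `η(X) = η(φX) = 0`. On the section of `X` and `φX` the
values of `π₁` and `π₂` agree and those of `π₃, π₄, π₅` vanish, so only the term in `A` survives. -/
theorem sectionalCurvature_φ (A : V →ₗ[ℝ] V) (T a b : ℝ) (x : V) :
    sectionalCurvature (fun x y => g x y) (hypersurfaceTensor g φ η A T a b) (φ x) (φ (φ x)) =
      -(pi1 (fun x y => g x y) (A (φ x)) (A (φ (φ x))) (φ (φ x)) (φ x)
        / pi1 (fun x y => g x y) (φ x) (φ (φ x)) (φ (φ x)) (φ x)) := by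
  rw [sectionalCurvature, ← neg_div]
  congr 1
  simp only [hypersurfaceTensor, pi1, pi2, pi3, pi4, pi5, h.φ_cube, h.η_φ, map_neg,
    h.symm (φ x) (φ (φ x))]
  ring

theorem sectionalCurvature_totallyReal (A : V →ₗ[ℝ] V) (T a b : ℝ) (x y : V)
    (hxy : NondegenerateSection (fun x y => g x y) x y)
    (ht : TotallyRealSection (fun x y => g x y) φ x y) (hx : g x ξ = 0) (hy : g y ξ = 0) :
    sectionalCurvature (fun x y => g x y) (hypersurfaceTensor g φ η A T a b) x y =
      a - pi1 (fun x y => g x y) (A x) (A y) y x / pi1 (fun x y => g x y) x y y x := by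
  rw [NondegenerateSection] at hxy
  obtain ⟨h1, h2, h3, h4⟩ := ht
  rw [h.η_eq] at hx hy
  rw [sectionalCurvature]
  field_simp
  simp only [hypersurfaceTensor, pi2, pi3, pi4, pi5, h1, h2, h3, h4, hx, hy]
  ring

end AlmostContactNorden

end AlmostContact

/-! ### Differential geometry of metrics, connections and hypersurfaces. -/

section Geometry

set_option maxSynthPendingDepth 3

/-! ### Levi-Civita connection of a metric on an open subset of a normed space -/

section LocalMetric

variable {E : Type*} [NormedAddCommGroup E] [NormedSpace ℝ E]

/-- `½ (D_u G(v,w) + D_v G(u,w) - D_w G(u,v))` as a trilinear form. -/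
def koszulForm (G : E → E →L[ℝ] E →L[ℝ] ℝ) (a : E) : E →L[ℝ] E →L[ℝ] E →L[ℝ] ℝ :=
  (1 / 2 : ℝ) • (fderiv ℝ G a + (fderiv ℝ G a).flip
    - (ContinuousLinearMap.flipₗᵢ ℝ E E ℝ).toContinuousLinearEquiv.toContinuousLinearMap ∘L
      (fderiv ℝ G a).flip)

/-- The Christoffel symbols of `G` as a bilinear map. -/
def connectionForm (G : E → E →L[ℝ] E →L[ℝ] ℝ) (a : E) : E →L[ℝ] E →L[ℝ] E :=
  (ContinuousLinearMap.compL ℝ E (E →L[ℝ] ℝ) E (G a).inverse) ∘L koszulForm G a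

/-- The curvature `∇_u ∇_v w - ∇_v ∇_u w` of a connection `D + Γ`, for constant `u, v, w`. -/
def connectionCurvature (Γ : E → E →L[ℝ] E →L[ℝ] E) (a u v w : E) : E :=
  fderiv ℝ Γ a u v w - fderiv ℝ Γ a v u w + Γ a u (Γ a v w) - Γ a v (Γ a u w)

theorem koszulForm_apply (G : E → E →L[ℝ] E →L[ℝ] ℝ) (a u v w : E) :
    koszulForm G a u v w
      = 1 / 2 * (fderiv ℝ G a u v w + fderiv ℝ G a v u w - fderiv ℝ G a w u v) := by
  simp [koszulForm]

theorem connectionForm_apply (G : E → E →L[ℝ] E →L[ℝ] ℝ) (a u v : E) :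
    connectionForm G a u v = (G a).inverse (koszulForm G a u v) := rfl

/-- A smooth pseudo-Riemannian metric on the open set `U`. -/
structure LocalMetric (U : Set E) (G : E → E →L[ℝ] E →L[ℝ] ℝ) : Prop where
  isOpen : IsOpen U
  smooth : ∀ a ∈ U, ContDiffAt ℝ ∞ G a
  symm : ∀ a ∈ U, ∀ u v, G a u v = G a v u
  nondegenerate : ∀ a ∈ U, ∀ u, (∀ v, G a u v = 0) → u = 0

/-- Injectivity into a dual of the same dimension. `ContinuousLinearMap.inverse` is zero on
non-invertible maps, so every index raised with it relies on this fact. -/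
theorem isInvertible_of_nondegenerate [FiniteDimensional ℝ E] (B : E →L[ℝ] E →L[ℝ] ℝ)
    (h : ∀ u, (∀ v, B u v = 0) → u = 0) : B.IsInvertible := by
  have hinj : Function.Injective B := by
    rw [injective_iff_map_eq_zero]
    exact fun u hu => h u fun v => by rw [hu]; rfl
  have hdim : Module.finrank ℝ E = Module.finrank ℝ (E →L[ℝ] ℝ) := by
    rw [← (LinearMap.toContinuousLinearMap : (E →ₗ[ℝ] ℝ) ≃ₗ[ℝ] (E →L[ℝ] ℝ)).finrank_eq]
    exact (Subspace.dual_finrank_eq (K := ℝ) (V := E)).symm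
  exact ⟨(LinearEquiv.ofInjectiveOfFinrankEq B.toLinearMap hinj hdim).toContinuousLinearEquiv,
    by ext; rfl⟩

namespace LocalMetric

variable {U : Set E} {G : E → E →L[ℝ] E →L[ℝ] ℝ} (h : LocalMetric U G) {a : E} (ha : a ∈ U)

include h ha

theorem differentiableAt : DifferentiableAt ℝ G a := (h.smooth a ha).differentiableAt (by simp)

theorem fderiv_symm (w u v : E) : fderiv ℝ G a w u v = fderiv ℝ G a w v u := by
  have hd := (h.differentiableAt ha).hasFDerivAt
  have h1 : ∀ u v, HasFDerivAt (fun b => G b u v) (((fderiv ℝ G a).flip u).flip v) a := fun u v => by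
    have := (hd.clm_apply (hasFDerivAt_const u a)).clm_apply (hasFDerivAt_const v a)
    refine this.congr_fderiv ?_
    ext w
    simp
  have h2 : (fun b => G b u v) =ᶠ[nhds a] fun b => G b v u :=
    Filter.eventuallyEq_of_mem (h.isOpen.mem_nhds ha) fun b hb => h.symm b hb u v
  have := (h1 v u).congr_of_eventuallyEq h2
  simpa using congrArg (fun l : E →L[ℝ] ℝ => l w) ((h1 u v).unique this)

variable [FiniteDimensional ℝ E]

theorem isInvertible : (G a).IsInvertible :=
  isInvertible_of_nondegenerate _ (h.nondegenerate a ha)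

theorem apply_connectionForm (u v : E) : G a (connectionForm G a u v) = koszulForm G a u v := by
  rw [connectionForm_apply]
  exact congrArg (fun l : (E →L[ℝ] ℝ) →L[ℝ] (E →L[ℝ] ℝ) => l (koszulForm G a u v))
    (h.isInvertible ha).self_comp_inverse

theorem connectionForm_eq_iff (u v w : E) :
    connectionForm G a u v = w ↔ ∀ z, koszulForm G a u v z = G a w z := by
  constructor
  · rintro rfl z
    rw [h.apply_connectionForm ha]
  · intro hw
    rw [connectionForm_apply, ContinuousLinearMap.ext hw]
    exact congrArg (fun l : E →L[ℝ] E => l w) (h.isInvertible ha).inverse_comp_self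

theorem connectionForm_symm (u v : E) : connectionForm G a u v = connectionForm G a v u := by
  rw [h.connectionForm_eq_iff ha]
  intro z
  rw [h.apply_connectionForm ha, koszulForm_apply, koszulForm_apply, h.fderiv_symm ha z u v]
  ring

/-- Compatibility of the connection with the metric: two Koszul expressions add up to the derivative
of `G`. -/
theorem fderiv_apply (w u v : E) : fderiv ℝ G a w u v
    = G a (connectionForm G a w u) v + G a u (connectionForm G a w v) := by
  rw [h.symm a ha u, h.apply_connectionForm ha, h.apply_connectionForm ha, koszulForm_apply,
    koszulForm_apply, h.fderiv_symm ha w u v, h.fderiv_symm ha v w u, h.fderiv_symm ha u w v]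
  ring

theorem contDiffAt_connectionForm : ContDiffAt ℝ ∞ (connectionForm G) a := by
  obtain ⟨e, he⟩ := h.isInvertible ha
  have h1 : ContDiffAt ℝ ∞ (fun b => (G b).inverse) a := by
    have := contDiffAt_map_inverse (n := ∞) e
    rw [he] at this
    exact this.comp a (h.smooth a ha)
  have h2 : ContDiffAt ℝ ∞ (fderiv ℝ G) a := (h.smooth a ha).fderiv_right (by simp)
  have h3 : ContDiffAt ℝ ∞ (fun b => (fderiv ℝ G b).flip) a :=
    (ContinuousLinearMap.flipₗᵢ ℝ E E (E →L[ℝ] ℝ)).contDiff.contDiffAt.comp a h2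
  have h4 : ContDiffAt ℝ ∞ (koszulForm G) a :=
    ((h2.add h3).sub (contDiffAt_const.clm_comp h3)).const_smul _
  exact ((ContinuousLinearMap.compL ℝ E (E →L[ℝ] ℝ) E).contDiff.contDiffAt.comp a h1).clm_comp h4

end LocalMetric

end LocalMetric

theorem two_le_infty : (2 : WithTop ℕ∞) ≤ ∞ := by
  exact WithTop.coe_le_coe.2 (le_top : (2 : ℕ∞) ≤ ⊤)

/-! ### Covariant derivatives along a map -/

section Along

variable {E E' : Type*} [NormedAddCommGroup E] [NormedSpace ℝ E]
  [NormedAddCommGroup E'] [NormedSpace ℝ E']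

/-- The covariant derivative `∇_u V = D_u V + Γ(DF u, V)` of a field `V` along a map `F`. -/
def covDeriv (Γ : E' → E' →L[ℝ] E' →L[ℝ] E') (F V : E → E') (u a : E) : E' :=
  fderiv ℝ V a u + Γ (F a) (fderiv ℝ F a u) (V a)

variable {Γ : E' → E' →L[ℝ] E' →L[ℝ] E'} {F V W : E → E'} {a : E}

theorem covDeriv_congr (hV : V =ᶠ[nhds a] W) (u : E) : covDeriv Γ F V u a = covDeriv Γ F W u a := by
  rw [covDeriv, covDeriv, hV.fderiv_eq, hV.eq_of_nhds]

theorem covDeriv_sub (hV : DifferentiableAt ℝ V a) (hW : DifferentiableAt ℝ W a) (u : E) :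
    covDeriv Γ F (fun b => V b - W b) u a = covDeriv Γ F V u a - covDeriv Γ F W u a := by
  simp only [covDeriv]
  rw [fderiv_fun_sub hV hW]
  simp
  abel

theorem covDeriv_smul {f : E → ℝ} (hf : DifferentiableAt ℝ f a) (hV : DifferentiableAt ℝ V a)
    (u : E) : covDeriv Γ F (fun b => f b • V b) u a
      = fderiv ℝ f a u • V a + f a • covDeriv Γ F V u a := by
  simp only [covDeriv]
  rw [fderiv_fun_smul hf hV]
  simp
  abel

/-- The curvature of the pulled-back connection is the pull-back of the curvature: second
derivatives of `F` and `V` cancel by symmetry, and so do the terms with one derivative of `V`. -/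
theorem covDeriv_covDeriv_sub (hΓ : ContDiffAt ℝ ∞ Γ (F a)) (hF : ContDiffAt ℝ ∞ F a)
    (hV : ContDiffAt ℝ ∞ V a) (u v : E) :
    covDeriv Γ F (covDeriv Γ F V v) u a - covDeriv Γ F (covDeriv Γ F V u) v a
      = connectionCurvature Γ (F a) (fderiv ℝ F a u) (fderiv ℝ F a v) (V a) := by
  have dF : HasFDerivAt F (fderiv ℝ F a) a := (hF.differentiableAt (by simp)).hasFDerivAt
  have dV : HasFDerivAt V (fderiv ℝ V a) a := (hV.differentiableAt (by simp)).hasFDerivAt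
  have dΓ : HasFDerivAt (fun b => Γ (F b)) (fderiv ℝ Γ (F a) ∘L fderiv ℝ F a) a :=
    (hΓ.differentiableAt (by simp)).hasFDerivAt.comp a dF
  have ddF : HasFDerivAt (fderiv ℝ F) (fderiv ℝ (fderiv ℝ F) a) a :=
    ((hF.fderiv_right (m := ∞) (by simp)).differentiableAt (by simp)).hasFDerivAt
  have ddV : HasFDerivAt (fderiv ℝ V) (fderiv ℝ (fderiv ℝ V) a) a :=
    ((hV.fderiv_right (m := ∞) (by simp)).differentiableAt (by simp)).hasFDerivAt
  have sF := (hF.isSymmSndFDerivAt (by simpa using two_le_infty)).eq u v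
  have sV := (hV.isSymmSndFDerivAt (by simpa using two_le_infty)).eq u v
  have key : ∀ u v, fderiv ℝ (covDeriv Γ F V v) a u = fderiv ℝ (fderiv ℝ V) a u v
      + (fderiv ℝ Γ (F a) (fderiv ℝ F a u) (fderiv ℝ F a v) (V a)
        + Γ (F a) (fderiv ℝ (fderiv ℝ F) a u v) (V a)
        + Γ (F a) (fderiv ℝ F a v) (fderiv ℝ V a u)) := by
    intro u v
    have := (ddV.clm_apply (hasFDerivAt_const v a)).add
      ((dΓ.clm_apply (ddF.clm_apply (hasFDerivAt_const v a))).clm_apply dV)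
    have e : HasFDerivAt (covDeriv Γ F V v) _ a := this
    rw [e.fderiv]
    simp
    abel
  rw [covDeriv, key, covDeriv.eq_def Γ F (covDeriv Γ F V u), key, sF, sV]
  simp only [covDeriv, connectionCurvature, map_add]
  abel

end Along

/-! ### Symmetries of the curvature tensor -/

section CurvatureSymmetries

variable {E : Type*} [NormedAddCommGroup E] [NormedSpace ℝ E]

theorem connectionCurvature_swap (Γ : E → E →L[ℝ] E →L[ℝ] E) (a u v w : E) :
    connectionCurvature Γ a v u w = -connectionCurvature Γ a u v w := by
  simp only [connectionCurvature]
  abel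

namespace LocalMetric

variable {U : Set E} {G : E → E →L[ℝ] E →L[ℝ] ℝ} (h : LocalMetric U G) {a : E} (ha : a ∈ U)
  [FiniteDimensional ℝ E]

include h ha

theorem hasFDerivAt_connectionForm :
    HasFDerivAt (connectionForm G) (fderiv ℝ (connectionForm G) a) a :=
  ((h.contDiffAt_connectionForm ha).differentiableAt (by simp)).hasFDerivAt

theorem fderiv_connectionForm_symm (u v w : E) :
    fderiv ℝ (connectionForm G) a u v w = fderiv ℝ (connectionForm G) a u w v := by
  have hd := h.hasFDerivAt_connectionForm ha
  have h1 : ∀ v w, HasFDerivAt (fun b => connectionForm G b v w)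
      (((fderiv ℝ (connectionForm G) a).flip v).flip w) a := fun v w => by
    have := (hd.clm_apply (hasFDerivAt_const v a)).clm_apply (hasFDerivAt_const w a)
    refine this.congr_fderiv ?_
    ext w
    simp
  have h2 : (fun b => connectionForm G b v w) =ᶠ[nhds a] fun b => connectionForm G b w v :=
    Filter.eventuallyEq_of_mem (h.isOpen.mem_nhds ha) fun b hb => h.connectionForm_symm hb v w
  have := (h1 w v).congr_of_eventuallyEq h2
  simpa using congrArg (fun l : E →L[ℝ] E => l u) ((h1 v w).unique this)

/-- Torsion-freeness: `Γ` and its derivative are symmetric in their vector arguments, so the cyclic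
sum cancels in pairs. -/
theorem connectionCurvature_bianchi (u v w : E) :
    connectionCurvature (connectionForm G) a u v w + connectionCurvature (connectionForm G) a v w u
      + connectionCurvature (connectionForm G) a w u v = 0 := by
  simp only [connectionCurvature]
  rw [h.fderiv_connectionForm_symm ha u v w, h.fderiv_connectionForm_symm ha v u w,
    h.fderiv_connectionForm_symm ha w v u, h.connectionForm_symm ha v w,
    h.connectionForm_symm ha u w, h.connectionForm_symm ha u v]
  abel

/-- Differentiating metric compatibility once more expresses the second derivative of `G` through
`Γ`. Its symmetry in `x` and `y` leaves exactly the skewness of the curvature operator. -/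
theorem apply_connectionCurvature_swap (x y z u : E) :
    G a (connectionCurvature (connectionForm G) a x y u) z
      = -G a (connectionCurvature (connectionForm G) a x y z) u := by
  have dG := (h.differentiableAt ha).hasFDerivAt
  have ddG : HasFDerivAt (fderiv ℝ G) (fderiv ℝ (fderiv ℝ G) a) a :=
    (((h.smooth a ha).fderiv_right (m := ∞) (by simp)).differentiableAt (by simp)).hasFDerivAt
  have dΓ := h.hasFDerivAt_connectionForm ha
  have key : ∀ x y, fderiv ℝ (fderiv ℝ G) a x y z u
      = G a (connectionForm G a x (connectionForm G a y z)) u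
        + G a (connectionForm G a y z) (connectionForm G a x u)
        + G a (fderiv ℝ (connectionForm G) a x y z) u
        + G a (connectionForm G a x z) (connectionForm G a y u)
        + G a z (connectionForm G a x (connectionForm G a y u))
        + G a z (fderiv ℝ (connectionForm G) a x y u) := by
    intro x y
    have e1 := ((ddG.clm_apply (hasFDerivAt_const y a)).clm_apply
      (hasFDerivAt_const z a)).clm_apply (hasFDerivAt_const u a)
    have f : ∀ z, HasFDerivAt (fun b => connectionForm G b y z) _ a := fun z =>
      (dΓ.clm_apply (hasFDerivAt_const y a)).clm_apply (hasFDerivAt_const z a)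
    have e2 := ((dG.clm_apply (f z)).clm_apply (hasFDerivAt_const u a)).add
      ((dG.clm_apply (hasFDerivAt_const z a)).clm_apply (f u))
    have e3 : (fun b => fderiv ℝ G b y z u) =ᶠ[nhds a] fun b =>
        G b (connectionForm G b y z) u + G b z (connectionForm G b y u) :=
      Filter.eventuallyEq_of_mem (h.isOpen.mem_nhds ha) fun b hb => h.fderiv_apply hb y z u
    have e4 := congrArg (fun l : E →L[ℝ] ℝ => l x) (e1.unique (e2.congr_of_eventuallyEq e3))
    simp at e4
    rw [e4, h.fderiv_apply ha, h.fderiv_apply ha]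
    ring
  have hs := ((h.smooth a ha).isSymmSndFDerivAt (by simpa using two_le_infty)).eq x y
  have hs' := congrArg (fun l : E →L[ℝ] E →L[ℝ] ℝ => l z u) hs
  simp only [key] at hs'
  rw [h.symm a ha _ z]
  simp only [connectionCurvature, map_add, map_sub, add_apply,
    sub_apply]
  linarith

theorem curvatureLike :
    CurvatureLike ℝ fun x y z u => G a (connectionCurvature (connectionForm G) a x y z) u where
  add x x' y z u := by simp [connectionCurvature]; ring
  smul c x y z u := by simp [connectionCurvature]; ring
  swap_left x y z u := by rw [connectionCurvature_swap]; simp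
  swap_right x y z u := h.apply_connectionCurvature_swap ha x y z u
  bianchi x y z u := by
    have := h.connectionCurvature_bianchi ha x y z
    rw [← add_apply, ← add_apply, ← map_add, ← map_add,
      this, map_zero, zero_apply]

/-- The curvature operators commute with a parallel endomorphism field. -/
theorem connectionCurvature_parallel {J : E → E →L[ℝ] E} (hJ : ContDiffAt ℝ ∞ J a)
    (hp : ∀ b ∈ U, ∀ u v, fderiv ℝ J b u v + connectionForm G b u (J b v)
      - J b (connectionForm G b u v) = 0) (x y z : E) :
    connectionCurvature (connectionForm G) a x y (J a z)
      = J a (connectionCurvature (connectionForm G) a x y z) := by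
  have dJ := (hJ.differentiableAt (by simp)).hasFDerivAt
  have ddJ : HasFDerivAt (fderiv ℝ J) (fderiv ℝ (fderiv ℝ J) a) a :=
    ((hJ.fderiv_right (m := ∞) (by simp)).differentiableAt (by simp)).hasFDerivAt
  have dΓ := h.hasFDerivAt_connectionForm ha
  have hp' : ∀ b ∈ U, ∀ u v, fderiv ℝ J b u v
      = J b (connectionForm G b u v) - connectionForm G b u (J b v) := fun b hb u v => by
    have := hp b hb u v
    rw [← sub_eq_zero, ← this]
    abel
  -- The equation `∇J = 0` is differentiated again; antisymmetrising in `x, y` kills the second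
  -- derivative of `J` and leaves the commutator of `J` with the curvature operator.
  have key : ∀ x y, fderiv ℝ (fderiv ℝ J) a x y z
      = J a (connectionForm G a x (connectionForm G a y z))
        - connectionForm G a x (J a (connectionForm G a y z))
        + J a (fderiv ℝ (connectionForm G) a x y z)
        - fderiv ℝ (connectionForm G) a x y (J a z)
        - connectionForm G a y (J a (connectionForm G a x z))
        + connectionForm G a y (connectionForm G a x (J a z)) := by
    intro x y
    have e1 := (ddJ.clm_apply (hasFDerivAt_const y a)).clm_apply (hasFDerivAt_const z a)
    have f : HasFDerivAt (fun b => connectionForm G b y z) _ a :=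
      (dΓ.clm_apply (hasFDerivAt_const y a)).clm_apply (hasFDerivAt_const z a)
    have e2 := (dJ.clm_apply f).sub ((dΓ.clm_apply (hasFDerivAt_const y a)).clm_apply
      (dJ.clm_apply (hasFDerivAt_const z a)))
    have e3 : (fun b => fderiv ℝ J b y z) =ᶠ[nhds a] fun b =>
        J b (connectionForm G b y z) - connectionForm G b y (J b z) :=
      Filter.eventuallyEq_of_mem (h.isOpen.mem_nhds ha) fun b hb => hp' b hb y z
    have e4 := congrArg (fun l : E →L[ℝ] E => l x) (e1.unique (e2.congr_of_eventuallyEq e3))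
    simp at e4
    rw [e4, hp' a ha, hp' a ha, map_sub]
    abel
  have hs := (hJ.isSymmSndFDerivAt (by simpa using two_le_infty)).eq x y
  have hs' := congrArg (fun l : E →L[ℝ] E => l z) hs
  simp only [key] at hs'
  rw [← sub_eq_zero] at hs' ⊢
  rw [← neg_eq_zero, ← hs']
  simp only [connectionCurvature, map_add, map_sub]
  abel

end LocalMetric

end CurvatureSymmetries

/-! ### The Gauss equation -/

section Gauss

variable {E E' : Type*} [NormedAddCommGroup E] [NormedSpace ℝ E] [FiniteDimensional ℝ E]
  [NormedAddCommGroup E'] [NormedSpace ℝ E'] [FiniteDimensional ℝ E']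

omit [FiniteDimensional ℝ E] in
/-- The covariant derivative along a map is metric. -/
theorem LocalMetric.fderiv_apply_apply {U' : Set E'} {G : E' → E' →L[ℝ] E' →L[ℝ] ℝ}
    (h' : LocalMetric U' G) {F V W : E → E'} {a : E} (ha : F a ∈ U')
    (hF : DifferentiableAt ℝ F a) (hV : DifferentiableAt ℝ V a) (hW : DifferentiableAt ℝ W a)
    (u : E) : fderiv ℝ (fun b => G (F b) (V b) (W b)) a u
      = G (F a) (covDeriv (connectionForm G) F V u a) (W a)
        + G (F a) (V a) (covDeriv (connectionForm G) F W u a) := by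
  have dG : HasFDerivAt (fun b => G (F b)) (fderiv ℝ G (F a) ∘L fderiv ℝ F a) a :=
    (h'.differentiableAt ha).hasFDerivAt.comp a hF.hasFDerivAt
  rw [((dG.clm_apply hV.hasFDerivAt).clm_apply hW.hasFDerivAt).fderiv]
  simp [covDeriv, h'.fderiv_apply ha]
  ring

/-- A map `F` into a space with metric `G`, with induced metric `H` and time-like unit normal
field `N`, spanning the normal spaces. -/
structure LocalHypersurface (U : Set E) (U' : Set E') (G : E' → E' →L[ℝ] E' →L[ℝ] ℝ)
    (H : E → E →L[ℝ] E →L[ℝ] ℝ) (F N : E → E') : Prop where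
  ambient : LocalMetric U' G
  induced : LocalMetric U H
  mapsTo : ∀ a ∈ U, F a ∈ U'
  smooth : ∀ a ∈ U, ContDiffAt ℝ ∞ F a
  smooth_normal : ∀ a ∈ U, ContDiffAt ℝ ∞ N a
  induced_eq : ∀ a ∈ U, ∀ u v, H a u v = G (F a) (fderiv ℝ F a u) (fderiv ℝ F a v)
  normal : ∀ a ∈ U, ∀ u, G (F a) (N a) (fderiv ℝ F a u) = 0
  unit : ∀ a ∈ U, G (F a) (N a) (N a) = -1
  span : ∀ a ∈ U, ∀ X, (∀ u, G (F a) X (fderiv ℝ F a u) = 0) → G (F a) X (N a) = 0 → X = 0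

namespace LocalHypersurface

variable {U : Set E} {U' : Set E'} {G : E' → E' →L[ℝ] E' →L[ℝ] ℝ}
    {H : E → E →L[ℝ] E →L[ℝ] ℝ} {F N : E → E'} (h : LocalHypersurface U U' G H F N)
    {a : E} (ha : a ∈ U)

include h ha

omit [FiniteDimensional ℝ E] [FiniteDimensional ℝ E'] in
theorem contDiffAt_fderiv (v : E) : ContDiffAt ℝ ∞ (fun b => fderiv ℝ F b v) a :=
  ((h.smooth a ha).fderiv_right (m := ∞) (by simp)).clm_apply contDiffAt_const

omit [FiniteDimensional ℝ E] in
theorem covDeriv_fderiv_symm (u v : E) :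
    covDeriv (connectionForm G) F (fun b => fderiv ℝ F b v) u a
      = covDeriv (connectionForm G) F (fun b => fderiv ℝ F b u) v a := by
  have d : HasFDerivAt (fderiv ℝ F) (fderiv ℝ (fderiv ℝ F) a) a :=
    (((h.smooth a ha).fderiv_right (m := ∞) (by simp)).differentiableAt (by simp)).hasFDerivAt
  have d' : ∀ u v, fderiv ℝ (fun b => fderiv ℝ F b v) a u = fderiv ℝ (fderiv ℝ F) a u v := by
    intro u v
    rw [(d.clm_apply (hasFDerivAt_const v a)).fderiv]
    simp
  rw [covDeriv, covDeriv, d', d', h.ambient.connectionForm_symm (h.mapsTo a ha),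
    ((h.smooth a ha).isSymmSndFDerivAt (by simpa using two_le_infty)).eq u v]

omit [FiniteDimensional ℝ E] in
theorem fderiv_induced (w u v : E) : fderiv ℝ H a w u v
    = G (F a) (covDeriv (connectionForm G) F (fun b => fderiv ℝ F b u) w a) (fderiv ℝ F a v)
      + G (F a) (covDeriv (connectionForm G) F (fun b => fderiv ℝ F b v) w a) (fderiv ℝ F a u) := by
  have e : (fun b => H b u v) =ᶠ[nhds a] fun b => G (F b) (fderiv ℝ F b u) (fderiv ℝ F b v) :=
    Filter.eventuallyEq_of_mem (h.induced.isOpen.mem_nhds ha) fun b hb => h.induced_eq b hb u v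
  have d := ((h.induced.differentiableAt ha).hasFDerivAt.clm_apply
    (hasFDerivAt_const u a)).clm_apply (hasFDerivAt_const v a)
  have e1 : fderiv ℝ (fun b => H b u v) a w = fderiv ℝ H a w u v := by
    rw [d.fderiv]; simp
  rw [← e1, e.fderiv_eq, h.ambient.fderiv_apply_apply (h.mapsTo a ha)
    ((h.smooth a ha).differentiableAt (by simp))
    ((h.contDiffAt_fderiv ha u).differentiableAt (by simp))
    ((h.contDiffAt_fderiv ha v).differentiableAt (by simp)),
    h.ambient.symm _ (h.mapsTo a ha) (fderiv ℝ F a u)]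

/-- The tangential part of the ambient derivative is symmetric and compatible with the induced
metric, so the Koszul computation identifies it with the Levi-Civita connection of `H`. -/
theorem apply_covDeriv_fderiv (u v w : E) :
    G (F a) (covDeriv (connectionForm G) F (fun b => fderiv ℝ F b v) u a) (fderiv ℝ F a w)
      = H a (connectionForm H a u v) w := by
  rw [h.induced.apply_connectionForm ha, koszulForm_apply]
  simp only [h.fderiv_induced ha, h.covDeriv_fderiv_symm ha v u, h.covDeriv_fderiv_symm ha w u,
    h.covDeriv_fderiv_symm ha w v]
  ring

/-- The Gauss formula. -/
theorem covDeriv_fderiv (u v : E) :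
    covDeriv (connectionForm G) F (fun b => fderiv ℝ F b v) u a
      = fderiv ℝ F a (connectionForm H a u v)
        - G (F a) (covDeriv (connectionForm G) F (fun b => fderiv ℝ F b v) u a) (N a) • N a := by
  -- Both sides are compared by pairing with tangent vectors and with `N`; the normal coefficient
  -- has a minus sign because `G(N,N) = -1`.
  rw [← sub_eq_zero]
  refine h.span a ha _ (fun w => ?_) ?_
  · simp [h.apply_covDeriv_fderiv ha, h.normal a ha, h.induced_eq a ha]
  · have := h.ambient.symm _ (h.mapsTo a ha) (fderiv ℝ F a (connectionForm H a u v)) (N a)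
    simp [this, h.normal a ha, h.unit a ha]

-- The Weingarten relation, from differentiating the orthogonality of `N` to the tangent vectors.
omit [FiniteDimensional ℝ E] in
theorem apply_covDeriv_normal (u v : E) :
    G (F a) (covDeriv (connectionForm G) F (fun b => fderiv ℝ F b v) u a) (N a)
      = -G (F a) (covDeriv (connectionForm G) F N u a) (fderiv ℝ F a v) := by
  have e : (fun b => G (F b) (N b) (fderiv ℝ F b v)) =ᶠ[nhds a] fun _ => 0 :=
    Filter.eventuallyEq_of_mem (h.induced.isOpen.mem_nhds ha) fun b hb => h.normal b hb v
  have e1 := congrArg (fun l : E →L[ℝ] ℝ => l u) e.fderiv_eq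
  simp only [fderiv_fun_const, Pi.zero_apply, zero_apply] at e1
  rw [h.ambient.fderiv_apply_apply (h.mapsTo a ha)
    ((h.smooth a ha).differentiableAt (by simp))
    ((h.smooth_normal a ha).differentiableAt (by simp))
    ((h.contDiffAt_fderiv ha v).differentiableAt (by simp)),
    h.ambient.symm _ (h.mapsTo a ha) (N a)] at e1
  linarith

omit [FiniteDimensional ℝ E] in
theorem contDiffAt_covDeriv_fderiv (u v : E) :
    ContDiffAt ℝ ∞ (covDeriv (connectionForm G) F (fun b => fderiv ℝ F b v) u) a := by
  have h1 := ((h.contDiffAt_fderiv ha v).fderiv_right (m := ∞) (by simp)).clm_apply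
    (contDiffAt_const (c := u))
  have h2 := (h.ambient.contDiffAt_connectionForm (h.mapsTo a ha)).comp a (h.smooth a ha)
  exact h1.add ((h2.clm_apply (h.contDiffAt_fderiv ha u)).clm_apply (h.contDiffAt_fderiv ha v))

/-- The tangential part of a second covariant derivative. -/
theorem apply_covDeriv_covDeriv (x y z u : E) :
    G (F a) (covDeriv (connectionForm G) F
        (covDeriv (connectionForm G) F (fun b => fderiv ℝ F b z) y) x a) (fderiv ℝ F a u)
      = H a (fderiv ℝ (connectionForm H) a x y z
          + connectionForm H a x (connectionForm H a y z)) u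
        + G (F a) (covDeriv (connectionForm G) F N y a) (fderiv ℝ F a z)
          * G (F a) (covDeriv (connectionForm G) F N x a) (fderiv ℝ F a u) := by
  have dY : HasFDerivAt (fun b => connectionForm H b y z) _ a :=
    ((h.induced.hasFDerivAt_connectionForm ha).clm_apply
      (hasFDerivAt_const y a)).clm_apply (hasFDerivAt_const z a)
  have ddF : HasFDerivAt (fderiv ℝ F) (fderiv ℝ (fderiv ℝ F) a) a :=
    (((h.smooth a ha).fderiv_right (m := ∞) (by simp)).differentiableAt (by simp)).hasFDerivAt
  have dB : DifferentiableAt ℝ (fun b =>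
      G (F b) (covDeriv (connectionForm G) F (fun b => fderiv ℝ F b z) y b) (N b)) a :=
    (((((h.ambient.smooth _ (h.mapsTo a ha)).comp a (h.smooth a ha)).clm_apply
      (h.contDiffAt_covDeriv_fderiv ha y z)).clm_apply (h.smooth_normal a ha)).differentiableAt
        (by simp))
  have dN := (h.smooth_normal a ha).differentiableAt (by simp)
  have dFY := ddF.clm_apply dY
  have e1 : covDeriv (connectionForm G) F (fun b => fderiv ℝ F b (connectionForm H b y z)) x a
      = covDeriv (connectionForm G) F (fun b => fderiv ℝ F b (connectionForm H a y z)) x a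
        + fderiv ℝ F a (fderiv ℝ (connectionForm H) a x y z) := by
    rw [covDeriv, covDeriv, dFY.fderiv, (ddF.clm_apply (hasFDerivAt_const _ a)).fderiv]
    simp
    abel
  -- The Gauss formula holds on a neighbourhood and may be differentiated. The derivative of the
  -- normal coefficient multiplies `N`, hence drops out against a tangent vector; the coefficient
  -- times the derivative of `N` gives the quadratic term.
  rw [covDeriv_congr (Filter.eventuallyEq_of_mem (h.induced.isOpen.mem_nhds ha)
      fun b hb => h.covDeriv_fderiv hb y z),
    covDeriv_sub dFY.differentiableAt (dB.fun_smul dN), covDeriv_smul dB dN, e1,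
    h.apply_covDeriv_normal ha]
  simp only [map_sub, map_add, map_smul, sub_apply,
    add_apply, smul_apply, h.normal a ha,
    h.apply_covDeriv_fderiv ha, ← h.induced_eq a ha, smul_eq_mul]
  ring

/-- The Gauss equation. -/
theorem gauss (x y z u : E) :
    H a (connectionCurvature (connectionForm H) a x y z) u
      = G (F a) (connectionCurvature (connectionForm G) (F a) (fderiv ℝ F a x) (fderiv ℝ F a y)
          (fderiv ℝ F a z)) (fderiv ℝ F a u)
        - (G (F a) (covDeriv (connectionForm G) F N y a) (fderiv ℝ F a z)
            * G (F a) (covDeriv (connectionForm G) F N x a) (fderiv ℝ F a u)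
          - G (F a) (covDeriv (connectionForm G) F N x a) (fderiv ℝ F a z)
            * G (F a) (covDeriv (connectionForm G) F N y a) (fderiv ℝ F a u)) := by
  rw [← covDeriv_covDeriv_sub (h.ambient.contDiffAt_connectionForm (h.mapsTo a ha))
    (h.smooth a ha) (h.contDiffAt_fderiv ha z), map_sub, sub_apply,
    h.apply_covDeriv_covDeriv ha, h.apply_covDeriv_covDeriv ha]
  simp only [connectionCurvature, map_sub, map_add, sub_apply,
    add_apply]
  ring

end LocalHypersurface

end Gauss

/-! ### Tensor fields in charts -/

section Charts

variable {E : Type*} [NormedAddCommGroup E] [NormedSpace ℝ E]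
  {M : Type*} [TopologicalSpace M] [ChartedSpace E M]

theorem isOpen_target (c : M) : IsOpen (extChartAt 𝓘(ℝ, E) c).target :=
  isOpen_extChartAt_target c

theorem pointAt_extChartAt {c q : M} (hq : q ∈ (extChartAt 𝓘(ℝ, E) c).source) :
    pointAt c (extChartAt 𝓘(ℝ, E) c q) = q :=
  (extChartAt 𝓘(ℝ, E) c).left_inv hq

variable [IsManifold 𝓘(ℝ, E) ∞ M]

theorem coordFrame_components {c : M} {a : E} (ha : a ∈ (extChartAt 𝓘(ℝ, E) c).target) :
    coordFrame c a ∘L components c (pointAt c a) = ContinuousLinearMap.id ℝ _ := by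
  have : IsManifold 𝓘(ℝ, E) 1 M := .of_le (n := ∞) (by simp)
  have := mfderivWithin_extChartAt_symm_comp_mfderiv_extChartAt (I := 𝓘(ℝ, E)) ha
  simp only [modelWithCornersSelf_coe, Set.range_id, mfderivWithin_univ] at this
  exact this

theorem components_self (p : M) : components (E := E) p p = ContinuousLinearMap.id ℝ _ :=
  have : IsManifold 𝓘(ℝ, E) 1 M := .of_le (n := ∞) (by simp)
  mfderiv_extChartAt_self

theorem components_surjective {c q : M} (hq : q ∈ (extChartAt 𝓘(ℝ, E) c).source) :
    Function.Surjective (components (E := E) c q) := by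
  have : IsManifold 𝓘(ℝ, E) 1 M := .of_le (n := ∞) (by simp)
  exact (isInvertible_mfderiv_extChartAt hq).bijective.2

theorem metricInChart_components (g : BilinField E M) {c q : M}
    (hq : q ∈ (extChartAt 𝓘(ℝ, E) c).source) (x y : TangentSpace 𝓘(ℝ, E) q) :
    metricInChart g c (extChartAt 𝓘(ℝ, E) c q) (components c q x) (components c q y)
      = g q x y := by
  obtain ⟨a, ha, rfl⟩ : ∃ a ∈ (extChartAt 𝓘(ℝ, E) c).target, pointAt c a = q :=
    ⟨_, (extChartAt 𝓘(ℝ, E) c).map_source hq, pointAt_extChartAt hq⟩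
  have h := coordFrame_components ha
  have e : extChartAt 𝓘(ℝ, E) c (pointAt c a) = a := (extChartAt 𝓘(ℝ, E) c).right_inv ha
  rw [e]
  change g (pointAt c a) ((coordFrame c a ∘L components c (pointAt c a)) x)
    ((coordFrame c a ∘L components c (pointAt c a)) y) = _
  rw [h]
  rfl

theorem endInChart_components (J : ∀ p : M, TangentSpace 𝓘(ℝ, E) p →L[ℝ] TangentSpace 𝓘(ℝ, E) p)
    {c q : M} (hq : q ∈ (extChartAt 𝓘(ℝ, E) c).source) (x : TangentSpace 𝓘(ℝ, E) q) :
    endInChart J c (extChartAt 𝓘(ℝ, E) c q) (components c q x) = components c q (J q x) := by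
  obtain ⟨a, ha, rfl⟩ : ∃ a ∈ (extChartAt 𝓘(ℝ, E) c).target, pointAt c a = q :=
    ⟨_, (extChartAt 𝓘(ℝ, E) c).map_source hq, pointAt_extChartAt hq⟩
  have h := coordFrame_components ha
  have e : extChartAt 𝓘(ℝ, E) c (pointAt c a) = a := (extChartAt 𝓘(ℝ, E) c).right_inv ha
  rw [e]
  change components c (pointAt c a) (J (pointAt c a)
    ((coordFrame c a ∘L components c (pointAt c a)) x)) = _
  rw [h]
  rfl

/-- A frame field is the tangent map of the inverse chart applied to a constant section, hence
smooth. -/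
theorem contMDiffAt_coordFrame {c : M} {a : E} (ha : a ∈ (extChartAt 𝓘(ℝ, E) c).target) (u : E) :
    ContMDiffAt 𝓘(ℝ, E) 𝓘(ℝ, E).tangent ∞
      (fun b => (⟨pointAt c b, coordFrame c b u⟩ : TangentBundle 𝓘(ℝ, E) M)) a := by
  have : IsManifold 𝓘(ℝ, E) 1 M := .of_le (n := ∞) (by simp)
  have hU := isOpen_target (E := E) c
  have h1 := (contMDiffOn_extChartAt_symm (I := 𝓘(ℝ, E)) (n := ∞) c).contMDiffOn_tangentMapWithin
    (m := ∞) (by simp) hU.uniqueMDiffOn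
  have h2 : ContMDiffAt 𝓘(ℝ, E) 𝓘(ℝ, E).tangent ∞
      (fun b : E => (⟨b, u⟩ : TangentBundle 𝓘(ℝ, E) E)) a :=
    contMDiffAt_vectorSpace_iff_contDiffAt.2 contDiffAt_const
  have h3 := h1.contMDiffAt (x := (⟨a, u⟩ : TangentBundle 𝓘(ℝ, E) E))
    ((hU.preimage (FiberBundle.continuous_proj E (TangentSpace 𝓘(ℝ, E)))).mem_nhds ha)
  refine (h3.comp a h2).congr_of_eventuallyEq ?_
  filter_upwards [hU.mem_nhds ha] with b hb
  simp only [Function.comp_apply, tangentMapWithin, mfderivWithin_of_isOpen hU hb]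
  rfl

theorem contMDiffAt_components {E₀ M₀ : Type*} [NormedAddCommGroup E₀] [NormedSpace ℝ E₀]
    [TopologicalSpace M₀] [ChartedSpace E₀ M₀] {f : M₀ → M}
    {V : ∀ q, TangentSpace 𝓘(ℝ, E) (f q)} {q : M₀}
    (hV : ContMDiffAt 𝓘(ℝ, E₀) 𝓘(ℝ, E).tangent ∞
      (fun q => (⟨f q, V q⟩ : TangentBundle 𝓘(ℝ, E) M)) q) {c : M}
    (hq : f q ∈ (extChartAt 𝓘(ℝ, E) c).source) :
    ContMDiffAt 𝓘(ℝ, E₀) 𝓘(ℝ, E) ∞ (fun q => components c (f q) (V q)) q := by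
  have : IsManifold 𝓘(ℝ, E) 1 M := .of_le (n := ∞) (by simp)
  have hU := isOpen_extChartAt_source (I := 𝓘(ℝ, E)) c
  have h0 : ContMDiffOn 𝓘(ℝ, E) 𝓘(ℝ, E) ∞ (extChartAt 𝓘(ℝ, E) c)
      (extChartAt 𝓘(ℝ, E) c).source := by
    rw [extChartAt_source]
    exact contMDiffOn_extChartAt
  have h1 := h0.contMDiffOn_tangentMapWithin (m := ∞) (by simp) hU.uniqueMDiffOn
  have h3 := h1.contMDiffAt (x := (⟨f q, V q⟩ : TangentBundle 𝓘(ℝ, E) M))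
    ((hU.preimage (FiberBundle.continuous_proj E (TangentSpace 𝓘(ℝ, E)))).mem_nhds hq)
  have h4 := (contMDiff_snd_tangentBundle_modelSpace E 𝓘(ℝ, E) (n := ∞)).contMDiffAt.comp q
    (h3.comp q hV)
  have hf : ContinuousAt f q :=
    (FiberBundle.continuous_proj E (TangentSpace 𝓘(ℝ, E))).continuousAt.comp hV.continuousAt
  refine h4.congr_of_eventuallyEq ?_
  filter_upwards [hf (hU.mem_nhds hq)] with b hb
  change _ = mfderivWithin 𝓘(ℝ, E) 𝓘(ℝ, E) (extChartAt 𝓘(ℝ, E) c) _ (f b) (V b)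
  rw [mfderivWithin_of_isOpen hU hb]
  rfl

variable [FiniteDimensional ℝ E]

theorem contDiffAt_metricInChart (g : BilinField E M)
    (hg : ContMDiff 𝓘(ℝ, E) (𝓘(ℝ, E).prod 𝓘(ℝ, E →L[ℝ] E →L[ℝ] ℝ)) ∞
    (fun p => Bundle.TotalSpace.mk' (E →L[ℝ] E →L[ℝ] ℝ)
      (E := fun p : M => TangentSpace 𝓘(ℝ, E) p →L[ℝ] TangentSpace 𝓘(ℝ, E) p →L[ℝ] ℝ) p (g p)))
    {c : M} {a : E} (ha : a ∈ (extChartAt 𝓘(ℝ, E) c).target) :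
    ContDiffAt ℝ ∞ (metricInChart g c) a := by
  have : IsManifold 𝓘(ℝ, E) 1 M := .of_le (n := ∞) (by simp)
  have hU := isOpen_target (E := E) c
  suffices ContDiffOn ℝ ∞ (metricInChart g c) (extChartAt 𝓘(ℝ, E) c).target from
    this.contDiffAt (hU.mem_nhds ha)
  rw [contDiffOn_clm_apply]
  intro u
  rw [contDiffOn_clm_apply]
  intro v b hb
  have h1 : ContMDiffAt 𝓘(ℝ, E) 𝓘(ℝ, E) ∞ (pointAt c : E → M) b :=
    (contMDiffOn_extChartAt_symm (I := 𝓘(ℝ, E)) (n := ∞) c).contMDiffAt (hU.mem_nhds hb)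
  have h2 := ContMDiffAt.clm_bundle_apply₂ (F₁ := E) (F₂ := E) (F₃ := ℝ)
    (E₃ := Bundle.Trivial M ℝ)
    (hg.contMDiffAt.comp b h1) (contMDiffAt_coordFrame hb u) (contMDiffAt_coordFrame hb v)
  rw [Bundle.contMDiffAt_totalSpace] at h2
  exact h2.2.contDiffAt.contDiffWithinAt

theorem contDiffAt_endInChart
    (J : ∀ p : M, TangentSpace 𝓘(ℝ, E) p →L[ℝ] TangentSpace 𝓘(ℝ, E) p)
    (hJ : ContMDiff 𝓘(ℝ, E) (𝓘(ℝ, E).prod 𝓘(ℝ, E →L[ℝ] E)) ∞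
    (fun p => Bundle.TotalSpace.mk' (E →L[ℝ] E)
      (E := fun p : M => TangentSpace 𝓘(ℝ, E) p →L[ℝ] TangentSpace 𝓘(ℝ, E) p) p (J p)))
    {c : M} {a : E} (ha : a ∈ (extChartAt 𝓘(ℝ, E) c).target) :
    ContDiffAt ℝ ∞ (endInChart J c) a := by
  have : IsManifold 𝓘(ℝ, E) 1 M := .of_le (n := ∞) (by simp)
  have hU := isOpen_target (E := E) c
  suffices ContDiffOn ℝ ∞ (endInChart J c) (extChartAt 𝓘(ℝ, E) c).target from
    this.contDiffAt (hU.mem_nhds ha)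
  rw [contDiffOn_clm_apply]
  intro u b hb
  have h1 : ContMDiffAt 𝓘(ℝ, E) 𝓘(ℝ, E) ∞ (pointAt c : E → M) b :=
    (contMDiffOn_extChartAt_symm (I := 𝓘(ℝ, E)) (n := ∞) c).contMDiffAt (hU.mem_nhds hb)
  have h2 := ContMDiffAt.clm_bundle_apply (F₁ := E) (F₂ := E)
    (hJ.contMDiffAt.comp b h1) (contMDiffAt_coordFrame hb u)
  exact (contMDiffAt_components h2 ((extChartAt 𝓘(ℝ, E) c).map_target hb)).contDiffAt.contDiffWithinAt

end Charts

/-! ### Christoffel symbols and curvature in a chart. -/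

section ChartCurvature

variable {E : Type*} [NormedAddCommGroup E] [NormedSpace ℝ E]
  {M : Type*} [TopologicalSpace M] [ChartedSpace E M]

theorem christoffel_eq_connectionForm (g : BilinField E M) (c : M) (a u v : E) :
    christoffel g c a u v = connectionForm (metricInChart g c) a u v := by
  rw [christoffel, connectionForm_apply]
  rfl

theorem curvatureInChart_eq_connectionCurvature (g : BilinField E M) (c : M) {a : E}
    (h : DifferentiableAt ℝ (connectionForm (metricInChart g c)) a) (u v w : E) :
    curvatureInChart g c a u v w
      = connectionCurvature (connectionForm (metricInChart g c)) a u v w := by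
  have key : ∀ u v, fderiv ℝ (fun b => connectionForm (metricInChart g c) b v w) a u
      = fderiv ℝ (connectionForm (metricInChart g c)) a u v w := fun u v => by
    rw [((h.hasFDerivAt.clm_apply (hasFDerivAt_const v a)).clm_apply
      (hasFDerivAt_const w a)).fderiv]
    simp
  simp only [curvatureInChart, christoffel_eq_connectionForm, key, connectionCurvature]

theorem exists_eq_extChartAt {c : M} {a : E} (ha : a ∈ (extChartAt 𝓘(ℝ, E) c).target) :
    ∃ q ∈ (extChartAt 𝓘(ℝ, E) c).source, extChartAt 𝓘(ℝ, E) c q = a ∧ pointAt c a = q :=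
  ⟨_, (extChartAt 𝓘(ℝ, E) c).map_target ha, (extChartAt 𝓘(ℝ, E) c).right_inv ha, rfl⟩

variable [IsManifold 𝓘(ℝ, E) ∞ M]

theorem localMetric_metricInChart (g : BilinField E M) (hs : ∀ p x y, g p x y = g p y x)
    (hnd : ∀ p x, (∀ y, g p x y = 0) → x = 0) {c : M} {U : Set E} (hU : IsOpen U)
    (hUc : U ⊆ (extChartAt 𝓘(ℝ, E) c).target) (hsm : ∀ a ∈ U, ContDiffAt ℝ ∞ (metricInChart g c) a) :
    LocalMetric U (metricInChart g c) where
  isOpen := hU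
  smooth := hsm
  symm a ha u v := hs _ _ _
  nondegenerate a ha u h := by
    obtain ⟨q, hq, rfl, -⟩ := exists_eq_extChartAt (hUc ha)
    obtain ⟨x, rfl⟩ := components_surjective hq u
    rw [hnd q x fun y => by rw [← metricInChart_components g hq, h], map_zero]

theorem metricInChart_self (g : BilinField E M) (p : M) (x y : TangentSpace 𝓘(ℝ, E) p) :
    metricInChart g p (extChartAt 𝓘(ℝ, E) p p) x y = g p x y := by
  have := metricInChart_components g (mem_extChartAt_source (I := 𝓘(ℝ, E)) p) x y
  rwa [components_self] at this

theorem endInChart_self (J : ∀ p : M, TangentSpace 𝓘(ℝ, E) p →L[ℝ] TangentSpace 𝓘(ℝ, E) p) (p : M)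
    (x : TangentSpace 𝓘(ℝ, E) p) :
    endInChart J p (extChartAt 𝓘(ℝ, E) p p) x = J p x := by
  have := endInChart_components J (mem_extChartAt_source (I := 𝓘(ℝ, E)) p) x
  rwa [components_self] at this

theorem inverse_components_self (p : M) :
    (components (E := E) p p).inverse = ContinuousLinearMap.id ℝ _ := by
  rw [components_self]
  exact ContinuousLinearMap.inverse_id

/-- At the centre of its preferred chart the differential of the chart is the identity, so tangent
vectors are their own components. -/
theorem curvature_eq (g : BilinField E M) (p : M)
    (h : DifferentiableAt ℝ (connectionForm (metricInChart g p)) (extChartAt 𝓘(ℝ, E) p p))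
    (x y z u : TangentSpace 𝓘(ℝ, E) p) :
    curvature g p x y z u = metricInChart g p (extChartAt 𝓘(ℝ, E) p p)
      (connectionCurvature (connectionForm (metricInChart g p)) (extChartAt 𝓘(ℝ, E) p p) x y z)
      u := by
  rw [curvature, inverse_components_self, components_self]
  exact (congrArg (fun v : TangentSpace 𝓘(ℝ, E) p => g p v u)
    (curvatureInChart_eq_connectionCurvature g p h x y z)).trans (metricInChart_self g p _ _).symm

end ChartCurvature

/-! ### The curvature tensor of a Kähler–Norden manifold -/

section KaehlerCurvature

variable {E : Type*} [NormedAddCommGroup E] [NormedSpace ℝ E]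
  {M : Type*} [TopologicalSpace M] [ChartedSpace E M] [IsManifold 𝓘(ℝ, E) ∞ M]

/-- A continuous bilinear form as a bilinear map. -/
def bilinOfCLM {V : Type*} [AddCommGroup V] [Module ℝ V] [TopologicalSpace V]
    [IsTopologicalAddGroup V] [ContinuousSMul ℝ V] (B : V →L[ℝ] V →L[ℝ] ℝ) : V →ₗ[ℝ] V →ₗ[ℝ] ℝ :=
  LinearMap.mk₂ ℝ (fun x y => B x y) (by simp) (by simp) (by simp) (by simp)

namespace KaehlerNorden

variable (K : KaehlerNorden E M)

theorem g_J_left (p : M) (x y : TangentSpace 𝓘(ℝ, E) p) :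
    K.g p (K.J p x) y = K.g p x (K.J p y) := by
  have := K.g_J p x (K.J p y)
  rw [K.J_sq, map_neg] at this
  linarith

variable [FiniteDimensional ℝ E]

theorem localMetric (c : M) :
    LocalMetric (extChartAt 𝓘(ℝ, E) c).target (metricInChart K.g c) :=
  localMetric_metricInChart K.g K.g_symm K.g_nondegenerate (isOpen_target c) subset_rfl
    fun _ ha => contDiffAt_metricInChart K.g K.g_smooth ha

theorem curvature_eq_connectionCurvature (p : M) (x y z u : TangentSpace 𝓘(ℝ, E) p) :
    curvature K.g p x y z u = metricInChart K.g p (extChartAt 𝓘(ℝ, E) p p)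
      (connectionCurvature (connectionForm (metricInChart K.g p)) (extChartAt 𝓘(ℝ, E) p p) x y z)
      u :=
  curvature_eq K.g p
    ((K.localMetric p).hasFDerivAt_connectionForm (mem_extChartAt_target p)).differentiableAt x y z u

theorem curvatureLike_curvature (p : M) :
    CurvatureLike ℝ (curvature K.g p) := by
  have := (K.localMetric p).curvatureLike (mem_extChartAt_target p)
  have e : curvature K.g p = fun x y z u => metricInChart K.g p (extChartAt 𝓘(ℝ, E) p p)
      (connectionCurvature (connectionForm (metricInChart K.g p)) (extChartAt 𝓘(ℝ, E) p p) x y z)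
      u := by
    funext x y z u
    exact K.curvature_eq_connectionCurvature p x y z u
  rw [e]
  exact this

/-- `R(x,y)` commutes with `J` because `J` is parallel, and `J` is self-adjoint for `g`. -/
theorem curvature_J (p : M) (x y z u : TangentSpace 𝓘(ℝ, E) p) :
    curvature K.g p x y (K.J p z) u = curvature K.g p x y z (K.J p u) := by
  have hp : ∀ b ∈ (extChartAt 𝓘(ℝ, E) p).target, ∀ u v, fderiv ℝ (endInChart K.J p) b u v
      + connectionForm (metricInChart K.g p) b u (endInChart K.J p b v)
      - endInChart K.J p b (connectionForm (metricInChart K.g p) b u v) = 0 := by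
    intro b hb u v
    have h := K.J_parallel p b hb u v
    have hd := ((contDiffAt_endInChart K.J K.J_smooth hb).differentiableAt (by simp)).hasFDerivAt
    rw [(hd.clm_apply (hasFDerivAt_const v b)).fderiv] at h
    simpa [christoffel_eq_connectionForm] using h
  have h := (K.localMetric p).connectionCurvature_parallel (mem_extChartAt_target p)
    (contDiffAt_endInChart K.J K.J_smooth (mem_extChartAt_target p)) hp x y z
  have e := endInChart_self K.J p z
  rw [e] at h
  refine (K.curvature_eq_connectionCurvature p x y _ u).trans
    (Eq.trans ?_ (K.curvature_eq_connectionCurvature p x y z _).symm)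
  exact (congrArg (fun v : E => metricInChart K.g p (extChartAt 𝓘(ℝ, E) p p) v u)
    (h.trans (endInChart_self K.J p _))).trans ((metricInChart_self K.g p _ _).trans
      ((K.g_J_left p _ _).trans (metricInChart_self K.g p _ _).symm))

theorem curvature_eq_of_hasConstTotallyRealCurvatures {ν νt : M → ℝ}
    (hK : K.HasConstTotallyRealCurvatures ν νt) (p : M) (x y z u : TangentSpace 𝓘(ℝ, E) p) :
    curvature K.g p x y z u =
      ν p * (pi1 (fun x y => K.g p x y) x y z u - pi2 (fun x y => K.g p x y) (K.J p) x y z u)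
        + νt p * pi3 (fun x y => K.g p x y) (K.J p) x y z u :=
  curvature_eq_of_constTotallyReal (bilinOfCLM (K.g p)) (K.J p).toLinearMap (curvature K.g p)
    (K.g_symm p) (K.g_nondegenerate p) (K.J_sq p) (K.g_J p) (K.curvatureLike_curvature p)
    (K.curvature_J p) (ν p) (νt p) (hK p) x y z u

end KaehlerNorden

end KaehlerCurvature

/-! ### The Gauss equation of a hypersurface -/

namespace TimelikeHypersurface

variable {E' : Type*} [NormedAddCommGroup E'] [NormedSpace ℝ E']
  {M' : Type*} [TopologicalSpace M'] [ChartedSpace E' M'] [IsManifold 𝓘(ℝ, E') ∞ M']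
  {K : KaehlerNorden E' M'}
  {E : Type*} [NormedAddCommGroup E] [NormedSpace ℝ E]
  {M : Type*} [TopologicalSpace M] [ChartedSpace E M] [IsManifold 𝓘(ℝ, E) ∞ M]
  (S : TimelikeHypersurface K E M)

theorem g_apply (p : M) (x y : TangentSpace 𝓘(ℝ, E) p) :
    S.g p x y = K.g (S.i p) (S.di p x) (S.di p y) := rfl

theorem g_symm (p : M) (x y : TangentSpace 𝓘(ℝ, E) p) : S.g p x y = S.g p y x :=
  K.g_symm _ _ _

theorem g_di_N (p : M) (x : TangentSpace 𝓘(ℝ, E) p) : K.g (S.i p) (S.di p x) (S.N p) = 0 :=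
  (K.g_symm _ _ _).trans (S.N_normal p x)

/-- The immersion in the charts around `p` and `i p`. -/
def localMap (p : M) (a : E) : E' := extChartAt 𝓘(ℝ, E') (S.i p) (S.i (pointAt p a))

/-- The components of the normal field in the charts around `p` and `i p`. -/
def localNormal (p : M) (a : E) : E' :=
  components (S.i p) (S.i (pointAt p a)) (S.N (pointAt p a))

/-- The domain of the immersion in the charts around `p` and `i p`. -/
def localDomain (p : M) : Set E :=
  (extChartAt 𝓘(ℝ, E) p).target ∩
    (extChartAt 𝓘(ℝ, E) p).symm ⁻¹' (S.i ⁻¹' (extChartAt 𝓘(ℝ, E') (S.i p)).source)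

theorem isOpen_localDomain (p : M) : IsOpen (S.localDomain p) :=
  (continuousOn_extChartAt_symm p).isOpen_inter_preimage (isOpen_target p)
    ((isOpen_extChartAt_source _).preimage S.i_smooth.continuous)

theorem extChartAt_mem_localDomain (p : M) : extChartAt 𝓘(ℝ, E) p p ∈ S.localDomain p :=
  ⟨mem_extChartAt_target p, by
    rw [Set.mem_preimage, Set.mem_preimage, extChartAt_to_inv]
    exact mem_extChartAt_source _⟩

theorem exists_of_mem_localDomain {p : M} {a : E} (ha : a ∈ S.localDomain p) :
    ∃ q ∈ (extChartAt 𝓘(ℝ, E) p).source, extChartAt 𝓘(ℝ, E) p q = a ∧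
      S.i q ∈ (extChartAt 𝓘(ℝ, E') (S.i p)).source := by
  obtain ⟨q, hq, e, e'⟩ := exists_eq_extChartAt ha.1
  refine ⟨q, hq, e, ?_⟩
  rw [← e']
  exact ha.2

theorem contMDiffAt_pointAt {p : M} {a : E} (ha : a ∈ (extChartAt 𝓘(ℝ, E) p).target) :
    ContMDiffAt 𝓘(ℝ, E) 𝓘(ℝ, E) ∞ (pointAt p : E → M) a :=
  (contMDiffOn_extChartAt_symm (I := 𝓘(ℝ, E)) (n := ∞) p).contMDiffAt
    ((isOpen_target p).mem_nhds ha)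

theorem contMDiffAt_extChartAt_of_mem {c q : M} (hq : q ∈ (extChartAt 𝓘(ℝ, E) c).source) :
    ContMDiffAt 𝓘(ℝ, E) 𝓘(ℝ, E) ∞ (extChartAt 𝓘(ℝ, E) c) q :=
  contMDiffAt_extChartAt' (by rwa [extChartAt_source] at hq)

theorem contDiffAt_localMap {p : M} {a : E} (ha : a ∈ S.localDomain p) :
    ContDiffAt ℝ ∞ (S.localMap p) a :=
  ((contMDiffAt_extChartAt_of_mem ha.2).comp a
    (S.i_smooth.contMDiffAt.comp a (contMDiffAt_pointAt ha.1))).contDiffAt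

theorem contDiffAt_localNormal {p : M} {a : E} (ha : a ∈ S.localDomain p) :
    ContDiffAt ℝ ∞ (S.localNormal p) a :=
  ((contMDiffAt_components S.N_smooth.contMDiffAt ha.2).comp a (contMDiffAt_pointAt ha.1)).contDiffAt

theorem localMap_extChartAt {p q : M} (hq : q ∈ (extChartAt 𝓘(ℝ, E) p).source) :
    S.localMap p (extChartAt 𝓘(ℝ, E) p q) = extChartAt 𝓘(ℝ, E') (S.i p) (S.i q) := by
  rw [localMap, pointAt_extChartAt hq]

theorem localNormal_extChartAt {p q : M} (hq : q ∈ (extChartAt 𝓘(ℝ, E) p).source) :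
    S.localNormal p (extChartAt 𝓘(ℝ, E) p q) = components (S.i p) (S.i q) (S.N q) := by
  rw [localNormal, pointAt_extChartAt hq]

theorem extChartAt_mem_localDomain_of_mem {p q : M} (hq : q ∈ (extChartAt 𝓘(ℝ, E) p).source)
    (hq' : S.i q ∈ (extChartAt 𝓘(ℝ, E') (S.i p)).source) :
    extChartAt 𝓘(ℝ, E) p q ∈ S.localDomain p :=
  ⟨(extChartAt 𝓘(ℝ, E) p).map_source hq, by
    rwa [Set.mem_preimage, Set.mem_preimage, (extChartAt 𝓘(ℝ, E) p).left_inv hq]⟩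

/-- The differential of a coordinate expression `f` of a map `f ∘ chart` on the manifold. -/
theorem fderiv_components {p q : M} (hq : q ∈ (extChartAt 𝓘(ℝ, E) p).source) {f : E → E'}
    {f' : M → E'} (hf : DifferentiableAt ℝ f (extChartAt 𝓘(ℝ, E) p q))
    (h : ∀ q ∈ (extChartAt 𝓘(ℝ, E) p).source, f (extChartAt 𝓘(ℝ, E) p q) = f' q)
    (x : TangentSpace 𝓘(ℝ, E) q) :
    fderiv ℝ f (extChartAt 𝓘(ℝ, E) p q) (components p q x) = mfderiv 𝓘(ℝ, E) 𝓘(ℝ, E') f' q x := by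
  have e : f' =ᶠ[nhds q] f ∘ extChartAt 𝓘(ℝ, E) p :=
    Filter.eventuallyEq_of_mem ((isOpen_extChartAt_source p).mem_nhds hq) fun q hq => (h q hq).symm
  have d := hf.hasFDerivAt.hasMFDerivAt.comp q
    ((contMDiffAt_extChartAt_of_mem hq).mdifferentiableAt (by simp)).hasMFDerivAt
  have d' := (d.congr_of_eventuallyEq e).mfderiv
  rw [d']
  rfl

theorem fderiv_localMap {p q : M} (hq : q ∈ (extChartAt 𝓘(ℝ, E) p).source)
    (hq' : S.i q ∈ (extChartAt 𝓘(ℝ, E') (S.i p)).source) (x : TangentSpace 𝓘(ℝ, E) q) :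
    fderiv ℝ (S.localMap p) (extChartAt 𝓘(ℝ, E) p q) (components p q x)
      = components (S.i p) (S.i q) (S.di q x) := by
  have hd := (S.contDiffAt_localMap (S.extChartAt_mem_localDomain_of_mem hq hq')).differentiableAt
    (by simp)
  rw [fderiv_components hq hd fun q hq => S.localMap_extChartAt hq]
  have d := ((contMDiffAt_extChartAt_of_mem hq').mdifferentiableAt (by simp)).hasMFDerivAt.comp q
    (S.i_smooth.contMDiffAt.mdifferentiableAt (by simp)).hasMFDerivAt
  have d' : mfderiv 𝓘(ℝ, E) 𝓘(ℝ, E') (fun q => extChartAt 𝓘(ℝ, E') (S.i p) (S.i q)) q = _ :=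
    d.mfderiv
  rw [d']
  rfl

variable [FiniteDimensional ℝ E] [FiniteDimensional ℝ E']
  (hdim : Module.finrank ℝ E' = Module.finrank ℝ E + 1)

include hdim

/-- By the dimension hypothesis the tangent space of `M` and `N` together span the ambient tangent
space, so nondegeneracy of `g'` applies. -/
theorem eq_zero_of_orthogonal (p : M) (v : TangentSpace 𝓘(ℝ, E') (S.i p))
    (hv : ∀ x, K.g (S.i p) v (S.di p x) = 0) (hN : K.g (S.i p) v (S.N p) = 0) : v = 0 := by
  have : FiniteDimensional ℝ (TangentSpace 𝓘(ℝ, E) p) := inferInstanceAs (FiniteDimensional ℝ E)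
  have : FiniteDimensional ℝ (TangentSpace 𝓘(ℝ, E') (S.i p)) :=
    inferInstanceAs (FiniteDimensional ℝ E')
  let L : TangentSpace 𝓘(ℝ, E) p × ℝ →ₗ[ℝ] TangentSpace 𝓘(ℝ, E') (S.i p) :=
    (S.di p).toLinearMap.coprod (LinearMap.toSpanSingleton ℝ _ (S.N p))
  have hL : ∀ x c, L (x, c) = S.di p x + c • S.N p := fun x c => by simp [L]
  have hinj : Function.Injective L := by
    rw [injective_iff_map_eq_zero]
    rintro ⟨x, c⟩ h
    rw [hL] at h
    have e := congrArg (fun w => K.g (S.i p) w (S.N p)) h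
    simp [S.g_di_N, S.N_unit] at e
    subst e
    rw [zero_smul, add_zero, ← map_zero (S.di p)] at h
    rw [S.i_immersion p h]
    rfl
  have hfin : Module.finrank ℝ (TangentSpace 𝓘(ℝ, E) p × ℝ)
      = Module.finrank ℝ (TangentSpace 𝓘(ℝ, E') (S.i p)) := by
    rw [Module.finrank_prod, Module.finrank_self]
    exact hdim.symm
  have hsurj := (LinearMap.injective_iff_surjective_of_finrank_eq_finrank hfin).1 hinj
  refine K.g_nondegenerate _ v fun w => ?_
  obtain ⟨⟨x, c⟩, rfl⟩ := hsurj w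
  rw [hL, map_add, map_smul, hv, hN, smul_zero, add_zero]

theorem g_nondegenerate (p : M) (x : TangentSpace 𝓘(ℝ, E) p) (h : ∀ y, S.g p x y = 0) : x = 0 := by
  have := S.eq_zero_of_orthogonal hdim p (S.di p x) h (S.g_di_N p x)
  rw [← map_zero (S.di p)] at this
  exact S.i_immersion p this

omit [FiniteDimensional ℝ E] [FiniteDimensional ℝ E'] hdim in
theorem metricInChart_g_eq {p : M} {a : E} (ha : a ∈ S.localDomain p) (u v : E) :
    metricInChart S.g p a u v = metricInChart K.g (S.i p) (S.localMap p a)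
      (fderiv ℝ (S.localMap p) a u) (fderiv ℝ (S.localMap p) a v) := by
  obtain ⟨q, hq, rfl, hq'⟩ := S.exists_of_mem_localDomain ha
  obtain ⟨x, rfl⟩ := components_surjective hq u
  obtain ⟨y, rfl⟩ := components_surjective hq v
  rw [metricInChart_components S.g hq, S.fderiv_localMap hq hq', S.fderiv_localMap hq hq',
    S.localMap_extChartAt hq, metricInChart_components K.g hq', S.g_apply]

theorem localHypersurface (p : M) :
    LocalHypersurface (S.localDomain p) (extChartAt 𝓘(ℝ, E') (S.i p)).target
      (metricInChart K.g (S.i p)) (metricInChart S.g p) (S.localMap p) (S.localNormal p) where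
  ambient := K.localMetric (S.i p)
  induced := by
    refine localMetric_metricInChart S.g S.g_symm (S.g_nondegenerate hdim) (S.isOpen_localDomain p)
      Set.inter_subset_left fun a ha => ?_
    -- Smoothness of the induced metric is derived from its local expression as the pull-back of the
    -- ambient metric by the immersion.
    have hF := (S.contDiffAt_localMap ha).fderiv_right (m := ∞) (by simp)
    have hG := (contDiffAt_metricInChart K.g K.g_smooth
      ((extChartAt 𝓘(ℝ, E') (S.i p)).map_source ha.2)).comp a (S.contDiffAt_localMap ha)
    have h1 := ((ContinuousLinearMap.compL ℝ E E' ℝ).flip.contDiff.contDiffAt.comp a hF).clm_comp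
      (hG.clm_comp hF)
    refine h1.congr_of_eventuallyEq ?_
    filter_upwards [(S.isOpen_localDomain p).mem_nhds ha] with b hb
    ext u v
    rw [S.metricInChart_g_eq hb]
    rfl
  mapsTo a ha := (extChartAt 𝓘(ℝ, E') (S.i p)).map_source ha.2
  smooth a ha := S.contDiffAt_localMap ha
  smooth_normal a ha := S.contDiffAt_localNormal ha
  induced_eq a ha u v := S.metricInChart_g_eq ha u v
  normal a ha u := by
    obtain ⟨q, hq, rfl, hq'⟩ := S.exists_of_mem_localDomain ha
    obtain ⟨x, rfl⟩ := components_surjective hq u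
    rw [S.fderiv_localMap hq hq', S.localMap_extChartAt hq, S.localNormal_extChartAt hq,
      metricInChart_components K.g hq']
    exact S.N_normal q x
  unit a ha := by
    obtain ⟨q, hq, rfl, hq'⟩ := S.exists_of_mem_localDomain ha
    rw [S.localMap_extChartAt hq, S.localNormal_extChartAt hq, metricInChart_components K.g hq',
      S.N_unit]
  span a ha X hX hN := by
    obtain ⟨q, hq, rfl, hq'⟩ := S.exists_of_mem_localDomain ha
    obtain ⟨v, rfl⟩ := components_surjective hq' X
    rw [S.localMap_extChartAt hq, S.localNormal_extChartAt hq,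
      metricInChart_components K.g hq'] at hN
    rw [S.eq_zero_of_orthogonal hdim q v (fun x => ?_) hN, map_zero]
    have := hX (components p q x)
    rwa [S.fderiv_localMap hq hq', S.localMap_extChartAt hq,
      metricInChart_components K.g hq'] at this

/-- The defining property of the tangential part, valid because the induced metric is invertible. -/
theorem g_tangentialPart (p : M) (v : TangentSpace 𝓘(ℝ, E') (S.i p)) (x : TangentSpace 𝓘(ℝ, E) p) :
    S.g p (S.tangentialPart p v) x = K.g (S.i p) v (S.di p x) := by
  have h : (S.g p).IsInvertible :=
    isInvertible_of_nondegenerate (E := E) (S.g p) (S.g_nondegenerate hdim p)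
  exact congrArg (fun l : TangentSpace 𝓘(ℝ, E) p →L[ℝ] ℝ => l x)
    (congrArg (fun L : (TangentSpace 𝓘(ℝ, E) p →L[ℝ] ℝ) →L[ℝ] (TangentSpace 𝓘(ℝ, E) p →L[ℝ] ℝ) =>
      L (K.g (S.i p) v ∘L S.di p)) h.self_comp_inverse)

theorem di_tangentialPart (p : M) (v : TangentSpace 𝓘(ℝ, E') (S.i p))
    (hv : K.g (S.i p) v (S.N p) = 0) : S.di p (S.tangentialPart p v) = v := by
  rw [← sub_eq_zero]
  refine S.eq_zero_of_orthogonal hdim p _ (fun x => ?_) ?_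
  · have := S.g_tangentialPart hdim p v x
    rw [S.g_apply] at this
    simp [this]
  · simp [S.g_di_N, hv]

theorem g_A (p : M) (x y : TangentSpace 𝓘(ℝ, E) p) :
    S.g p (S.A p x) y = -K.g (S.i p) (S.nablaNormal p x) (S.di p y) := by
  have := S.g_tangentialPart hdim p (S.nablaNormal p x) y
  change S.g p (-S.tangentialPart p (S.nablaNormal p x)) y = _
  rw [map_neg, ← this]
  rfl

omit [FiniteDimensional ℝ E] [FiniteDimensional ℝ E'] hdim in
theorem fderiv_localMap_self (p : M) (x : TangentSpace 𝓘(ℝ, E) p) :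
    fderiv ℝ (S.localMap p) (extChartAt 𝓘(ℝ, E) p p) x = S.di p x := by
  have h := S.fderiv_localMap (mem_extChartAt_source (I := 𝓘(ℝ, E)) p) (mem_extChartAt_source _) x
  rwa [components_self, components_self] at h

omit [FiniteDimensional ℝ E] [FiniteDimensional ℝ E'] hdim in
theorem nablaNormal_eq_covDeriv (p : M) (x : TangentSpace 𝓘(ℝ, E) p) :
    S.nablaNormal p x = covDeriv (connectionForm (metricInChart K.g (S.i p))) (S.localMap p)
      (S.localNormal p) x (extChartAt 𝓘(ℝ, E) p p) := by
  have hp := mem_extChartAt_source (I := 𝓘(ℝ, E)) p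
  have h1 := fderiv_components hp
    ((S.contDiffAt_localNormal (S.extChartAt_mem_localDomain p)).differentiableAt (by simp))
    (fun q hq => S.localNormal_extChartAt hq) x
  rw [components_self] at h1
  have h2 := S.localNormal_extChartAt hp
  rw [components_self] at h2
  rw [nablaNormal, inverse_components_self, christoffel_eq_connectionForm, components_self]
  refine congrArg₂ (fun v w : E' => v + w) h1.symm ?_
  rw [S.localMap_extChartAt hp, h2, S.fderiv_localMap_self]
  rfl

theorem gauss_equation (p : M) (x y z u : TangentSpace 𝓘(ℝ, E) p) :
    curvature S.g p x y z u
      = curvature K.g (S.i p) (S.di p x) (S.di p y) (S.di p z) (S.di p u)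
        - pi1 (fun x y => S.g p x y) (S.A p x) (S.A p y) z u := by
  have hS := S.localHypersurface hdim p
  have hp := S.extChartAt_mem_localDomain p
  have hF := S.localMap_extChartAt (mem_extChartAt_source (I := 𝓘(ℝ, E)) p)
  have hA : ∀ x z : TangentSpace 𝓘(ℝ, E) p,
      metricInChart K.g (S.i p) (S.localMap p (extChartAt 𝓘(ℝ, E) p p))
        (covDeriv (connectionForm (metricInChart K.g (S.i p))) (S.localMap p)
          (S.localNormal p) x (extChartAt 𝓘(ℝ, E) p p))
        (fderiv ℝ (S.localMap p) (extChartAt 𝓘(ℝ, E) p p) z) = -S.g p (S.A p x) z := by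
    intro x z
    rw [hF, S.fderiv_localMap_self]
    refine Eq.trans (congrArg (fun v : E' => metricInChart K.g (S.i p)
      (extChartAt 𝓘(ℝ, E') (S.i p) (S.i p)) v (S.di p z)) (S.nablaNormal_eq_covDeriv p x).symm) ?_
    refine (metricInChart_self K.g (S.i p) _ _).trans ?_
    rw [S.g_A hdim, neg_neg]
  have hR : metricInChart K.g (S.i p) (S.localMap p (extChartAt 𝓘(ℝ, E) p p))
      (connectionCurvature (connectionForm (metricInChart K.g (S.i p)))
        (S.localMap p (extChartAt 𝓘(ℝ, E) p p))
        (fderiv ℝ (S.localMap p) (extChartAt 𝓘(ℝ, E) p p) x)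
        (fderiv ℝ (S.localMap p) (extChartAt 𝓘(ℝ, E) p p) y)
        (fderiv ℝ (S.localMap p) (extChartAt 𝓘(ℝ, E) p p) z))
      (fderiv ℝ (S.localMap p) (extChartAt 𝓘(ℝ, E) p p) u)
      = curvature K.g (S.i p) (S.di p x) (S.di p y) (S.di p z) (S.di p u) := by
    rw [hF, S.fderiv_localMap_self, S.fderiv_localMap_self, S.fderiv_localMap_self,
      S.fderiv_localMap_self]
    exact (K.curvature_eq_connectionCurvature (S.i p) _ _ _ _).symm
  have e := curvature_eq S.g p (hS.induced.hasFDerivAt_connectionForm hp).differentiableAt x y z u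
  refine (e.trans (hS.gauss hp x y z u)).trans ?_
  refine (congrArg₂ (fun r s : ℝ => r - s) hR (congrArg₂ (fun r s : ℝ => r - s)
    (congrArg₂ (fun r s : ℝ => r * s) (hA y z) (hA x u))
    (congrArg₂ (fun r s : ℝ => r * s) (hA x z) (hA y u)))).trans ?_
  simp only [pi1]
  ring

end TimelikeHypersurface

/-! ### The structure of a hypersurface -/

namespace TimelikeHypersurface

variable {E' : Type*} [NormedAddCommGroup E'] [NormedSpace ℝ E'] [FiniteDimensional ℝ E']
  {M' : Type*} [TopologicalSpace M'] [ChartedSpace E' M'] [IsManifold 𝓘(ℝ, E') ∞ M']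
  {K : KaehlerNorden E' M'}
  {E : Type*} [NormedAddCommGroup E] [NormedSpace ℝ E] [FiniteDimensional ℝ E]
  {M : Type*} [TopologicalSpace M] [ChartedSpace E M] [IsManifold 𝓘(ℝ, E) ∞ M]
  (S : TimelikeHypersurface K E M)

omit [FiniteDimensional ℝ E] [FiniteDimensional ℝ E']

theorem cos_t_pos (p : M) : 0 < Real.cos (S.t p) := Real.cos_arctan_pos _

theorem g_N_JN (p : M) : K.g (S.i p) (S.N p) (S.JN p) = Real.tan (S.t p) :=
  (Real.tan_arctan _).symm

theorem cos_mul_g_N_JN (p : M) :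
    Real.cos (S.t p) * K.g (S.i p) (S.N p) (S.JN p) = Real.sin (S.t p) := by
  rw [S.g_N_JN, mul_comm, Real.tan_mul_cos (S.cos_t_pos p).ne']

theorem g_JN_N (p : M) : K.g (S.i p) (S.JN p) (S.N p) = K.g (S.i p) (S.N p) (S.JN p) :=
  K.g_symm _ _ _

theorem g_JN_JN (p : M) : K.g (S.i p) (S.JN p) (S.JN p) = 1 := by
  rw [JN, K.g_J, S.N_unit, neg_neg]

theorem J_JN (p : M) : K.J (S.i p) (S.JN p) = -S.N p := K.J_sq _ _

theorem η_apply (p : M) (x : TangentSpace 𝓘(ℝ, E) p) :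
    S.η p x = Real.cos (S.t p) * K.g (S.i p) (S.JN p) (S.di p x) := rfl

theorem cos_mul_g_di_JN (p : M) (x : TangentSpace 𝓘(ℝ, E) p) :
    Real.cos (S.t p) * K.g (S.i p) (S.di p x) (S.JN p) = S.η p x := by
  rw [K.g_symm, S.η_apply]

variable [FiniteDimensional ℝ E] [FiniteDimensional ℝ E']
  (hdim : Module.finrank ℝ E' = Module.finrank ℝ E + 1)

include hdim

theorem di_ξ (p : M) :
    S.di p (S.ξ p) = Real.sin (S.t p) • S.N p + Real.cos (S.t p) • S.JN p := by
  refine S.di_tangentialPart hdim p _ ?_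
  simp only [map_add, map_smul, add_apply, smul_apply, smul_eq_mul, S.N_unit, S.g_JN_N,
    S.cos_mul_g_N_JN]
  ring

theorem di_φ (p : M) (x : TangentSpace 𝓘(ℝ, E) p) :
    S.di p (S.φ p x) = K.J (S.i p) (S.di p x)
      + S.η p x • (Real.cos (S.t p) • S.N p - Real.sin (S.t p) • S.JN p) := by
  refine S.di_tangentialPart hdim p _ ?_
  have hc := (S.cos_t_pos p).ne'
  have e1 := S.cos_mul_g_N_JN p
  have e2 := S.cos_mul_g_di_JN p x
  have e3 := Real.sin_sq_add_cos_sq (S.t p)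
  have e4 : K.g (S.i p) (K.J (S.i p) (S.di p x)) (S.N p) = K.g (S.i p) (S.di p x) (S.JN p) :=
    K.g_J_left _ _ _
  change K.g (S.i p) (K.J (S.i p) (S.di p x)
    + S.η p x • (Real.cos (S.t p) • S.N p - Real.sin (S.t p) • S.JN p)) (S.N p) = 0
  simp only [map_add, map_sub, map_smul, add_apply, sub_apply, smul_apply, smul_eq_mul, S.N_unit,
    S.g_JN_N, e4]
  refine (mul_eq_zero.1 ?_).resolve_left hc
  linear_combination e2 - S.η p x * Real.sin (S.t p) * e1 - S.η p x * e3

/-- `φ` differs from `J` by a multiple of `cos t N - sin t JN`; pairing with a tangent vector leaves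
only the `JN` part, whose size is `tan t η(x)η(y)`. -/
theorem g_di_J_di (p : M) (x y : TangentSpace 𝓘(ℝ, E) p) :
    K.g (S.i p) (S.di p x) (K.J (S.i p) (S.di p y))
      = S.g p x (S.φ p y) + Real.tan (S.t p) * S.η p x * S.η p y := by
  have hc := (S.cos_t_pos p).ne'
  have e2 := S.cos_mul_g_di_JN p x
  rw [S.g_apply, S.di_φ hdim]
  simp only [map_add, map_sub, map_smul, smul_eq_mul, S.g_di_N]
  rw [← e2, Real.tan_eq_sin_div_cos]
  field_simp
  ring

theorem almostContactNorden (p : M) :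
    AlmostContactNorden (bilinOfCLM (S.g p)) (S.φ p).toLinearMap (S.ξ p) (S.η p).toLinearMap := by
  have e1 := S.cos_mul_g_N_JN p
  have e3 := Real.sin_sq_add_cos_sq (S.t p)
  have hinj : ∀ x y, S.di p x = S.di p y → x = y := fun x y h => S.i_immersion p h
  have hξ : S.g p (S.ξ p) (S.ξ p) = 1 := by
    rw [S.g_apply, S.di_ξ hdim]
    simp only [map_add, map_smul, add_apply, smul_apply, smul_eq_mul, S.N_unit, S.g_JN_N,
      S.g_JN_JN]
    linear_combination e3 + 2 * Real.sin (S.t p) * e1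
  have hη : ∀ x, S.g p x (S.ξ p) = S.η p x := fun x => by
    rw [S.g_apply, S.di_ξ hdim, map_add, map_smul, map_smul, S.g_di_N, smul_zero, zero_add,
      smul_eq_mul, S.cos_mul_g_di_JN]
  have hφ : ∀ x y, S.g p (S.φ p x) y = S.g p x (S.φ p y) := fun x y => by
    have h1 := S.g_di_J_di hdim p x y
    have h2 := S.g_di_J_di hdim p y x
    rw [← K.g_J_left, K.g_symm] at h2
    rw [S.g_symm]
    linarith
  have hφξ : S.φ p (S.ξ p) = 0 := by
    refine hinj _ _ ?_
    rw [S.di_φ hdim, S.di_ξ hdim, ← hη, hξ, map_add, map_smul, map_smul, S.J_JN, map_zero,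
      ← JN]
    module
  refine ⟨S.g_symm p, S.g_nondegenerate hdim p, hξ, hη, hφ, hφξ, fun x => hinj _ _ ?_⟩
  have h0 : S.η p (S.φ p x) = 0 := by rw [← hη, hφ, hφξ, map_zero]
  change S.di p (S.φ p (S.φ p x)) = S.di p (-x + S.η p x • S.ξ p)
  rw [S.di_φ hdim, h0, S.di_φ hdim, map_add, map_add, map_smul, map_smul, map_sub, map_smul,
    map_smul, K.J_sq, S.J_JN, ← JN, S.di_ξ hdim, map_neg]
  module

theorem curvature_eq_hypersurfaceTensor {ν νt : M' → ℝ}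
    (hK : K.HasConstTotallyRealCurvatures ν νt) (p : M) :
    curvature S.g p = hypersurfaceTensor (bilinOfCLM (S.g p)) (S.φ p).toLinearMap
      (S.η p).toLinearMap (S.A p) (Real.tan (S.t p)) (ν (S.i p)) (νt (S.i p)) := by
  funext x y z u
  rw [S.gauss_equation hdim, K.curvature_eq_of_hasConstTotallyRealCurvatures hK]
  change _ = ν (S.i p) * (pi1 (fun x y => S.g p x y) x y z u
      - pi2 (fun x y => S.g p x y) (S.φ p) x y z u
      - Real.tan (S.t p) * pi5 (fun x y => S.g p x y) (S.φ p) (S.η p) x y z u)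
    + νt (S.i p) * (pi3 (fun x y => S.g p x y) (S.φ p) x y z u
      - Real.tan (S.t p) * pi4 (fun x y => S.g p x y) (S.η p) x y z u)
    - pi1 (fun x y => S.g p x y) (S.A p x) (S.A p y) z u
  -- The terms linear in `tan t` are `tan t π₅` from `π₂` and `-tan t π₄` from `π₃`; the quadratic
  -- terms in `π₂` cancel by antisymmetry.
  simp only [pi1, pi2, pi3, pi4, pi5, S.g_di_J_di hdim, ← S.g_apply]
  ring

end TimelikeHypersurface

end Geometry

end NordenGeometry

/-! ### The curvature formulas for the hypersurface. -/

open NordenGeometry in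
theorem proposition2p1
    {E' : Type*} [NormedAddCommGroup E'] [NormedSpace ℝ E']
    {M' : Type*} [TopologicalSpace M'] [ChartedSpace E' M'] [IsManifold 𝓘(ℝ, E') ∞ M']
    {E : Type*} [NormedAddCommGroup E] [NormedSpace ℝ E]
    {M : Type*} [TopologicalSpace M] [ChartedSpace E M] [IsManifold 𝓘(ℝ, E) ∞ M]
    (n : ℕ) (hE' : Module.finrank ℝ E' = 2 * n + 2) (hE : Module.finrank ℝ E = 2 * n + 1)
    (K : KaehlerNorden E' M') (ν νt : M' → ℝ) (hK : K.HasConstTotallyRealCurvatures ν νt)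
    (S : TimelikeHypersurface K E M) (p : M) :
    -- the induced metric, curvature tensor, structure tensors and constants at the point `p`
    let g : TangentSpace 𝓘(ℝ, E) p → TangentSpace 𝓘(ℝ, E) p → ℝ := fun x y => S.g p x y
    let R := curvature S.g p
    let φ := S.φ p
    let ξ := S.ξ p
    let η := S.η p
    let A := S.A p
    let T : ℝ := Real.tan (S.t p)
    let a : ℝ := ν (S.i p)
    let b : ℝ := νt (S.i p)
    -- the curvature tensor
    (∀ x y z u, R x y z u =
      a * (pi1 g x y z u - pi2 g φ x y z u - T * pi5 g φ η x y z u)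
        + b * (pi3 g φ x y z u - T * pi4 g η x y z u)
        - pi1 g (A x) (A y) z u) ∧
    -- the scalar curvatures of `R` and of the associated tensor, in every basis
    (∀ e : Module.Basis (Fin (2 * n + 1)) ℝ (TangentSpace 𝓘(ℝ, E) p),
      scalarCurvature g e R =
        4 * n ^ 2 * a - 4 * n * b * T
          - (LinearMap.trace ℝ _ A) ^ 2 + LinearMap.trace ℝ _ (A ∘ₗ A)) ∧
    (∀ e : Module.Basis (Fin (2 * n + 1)) ℝ (TangentSpace 𝓘(ℝ, E) p),
      scalarCurvature g e (associatedTensor φ R) =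
        2 * n * a * T + 2 * n * (2 * n - 1) * b
          - LinearMap.trace ℝ _ A * LinearMap.trace ℝ _ (A ∘ₗ φ.toLinearMap)
          + LinearMap.trace ℝ _ (A ∘ₗ A ∘ₗ φ.toLinearMap)) ∧
    -- `ξ`-sections
    (∀ x, NondegenerateSection g ξ x →
      sectionalCurvature g R ξ x =
        a - b * T - (a * T + b) * (g x (φ x) / (g x x - η x ^ 2))
          - pi1 g (A ξ) (A x) x ξ / (g x x - η x ^ 2)) ∧
    -- `φ`-holomorphic sections
    (∀ x, NondegenerateSection g (φ x) (φ (φ x)) →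
      sectionalCurvature g R (φ x) (φ (φ x)) =
        -(pi1 g (A (φ x)) (A (φ (φ x))) (φ (φ x)) (φ x)
          / pi1 g (φ x) (φ (φ x)) (φ (φ x)) (φ x))) ∧
    -- totally real sections orthogonal to `ξ`
    (∀ x y, NondegenerateSection g x y → TotallyRealSection g φ x y →
      g x ξ = 0 → g y ξ = 0 →
      sectionalCurvature g R x y = a - pi1 g (A x) (A y) y x / pi1 g x y y x) := by
  -- `finrank` is 0 in infinite dimension, so the prescribed positive dimensions force finiteness.
  have : FiniteDimensional ℝ E' := .of_finrank_pos (by omega)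
  have : FiniteDimensional ℝ E := .of_finrank_pos (by omega)
  have : FiniteDimensional ℝ (TangentSpace 𝓘(ℝ, E) p) := inferInstanceAs (FiniteDimensional ℝ E)
  have hdim : Module.finrank ℝ E' = Module.finrank ℝ E + 1 := by omega
  have h := S.almostContactNorden hdim p
  have hR := S.curvature_eq_hypersurfaceTensor hdim hK p
  have hT : Module.finrank ℝ (TangentSpace 𝓘(ℝ, E) p) = 2 * n + 1 := hE
  intro g R φ ξ η A T a b
  have hR' : R = hypersurfaceTensor (bilinOfCLM (S.g p)) φ.toLinearMap η.toLinearMap A T a b := hR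
  rw [hR']
  exact ⟨fun x y z u => rfl, fun e => h.scalarCurvature_hypersurfaceTensor e hT A T a b,
    fun e => h.scalarCurvature_associatedTensor e hT A T a b,
    fun x hx => h.sectionalCurvature_ξ A T a b x hx, fun x _ => h.sectionalCurvature_φ A T a b x,
    fun x y hxy ht hx hy => h.sectionalCurvature_totallyReal A T a b x y hxy ht hx hy⟩
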